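/- Let $d\in\{2,3\}$ and let $\Omega\subset\mathbb R^d$ be a (bounded) polygonal/polyhedral domain, i.e. a nonempty connected open set that is the interior of its closure, the closure being a finite union of nondegenerate closed simplices. Let $\Omega_1,\dots,\Omega_M$ be pairwise disjoint polyhedral domains with $\overline\Omega=\bigcup_{m=1}^M\overline{\Omega}_m$, and let $\Gamma_D\subset\partial\Omega$ have positive $(d-1)$-dimensional measure. Let $I=\{m:\operatorname{meas}_{d-1}(\partial\Omega_m\cap\Gamma_D)=0\}$ be the set of indices of the floating subdomains and $m_0=|I|$. For $\omega=(\omega_m)$ with all $\omega_m>0$ and $\rho=(\rho_m)$ with all $\rho_m\ge0$ put $$a(u,v)=\sum_{m=1}^M\int_{\Omega_m}\omega_m\nabla u\cdot\nabla v\,dx+\sum_{m=1}^M\int_{\Omega_m}\rho_m uv\,dx,\qquad \mathcal J(\omega)=\frac{\max_m\omega_m}{\min_m\omega_m}.$$ Let $\mathcal T_h$ be a finite conforming simplicial triangulation of $\overline\Omega$ such that each $\overline\Omega_m$ is a union of elements and $\Gamma_D$ is a union of (closed) $(d-1)$-dimensional faces, and let $h$ be the largest diameter of its elements; $\mathcal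 T_h$ is called quasi-uniform with constant $\sigma>0$ if every element contains a ball of radius $\sigma h$. Let $V_h$ be the space of continuous functions on $\overline\Omega$ that are affine on each element and vanish on $\Gamma_D$, let $\phi_1,\dots,\phi_N$ be its nodal basis, $\mathbb A=(a(\phi_j,\phi_i))_{i,j}$ the stiffness matrix and $\mathbb D$ its diagonal. Theorem (Jacobi preconditioning). For every $\sigma>0$ there is a constant $C>0$, depending only on $\sigma$ and on the geometric data $\Omega,\Omega_1,\dots,\Omega_M,\Gamma_D$ (in particular not on $h$, $\omega$, $\rho$), such that for all such triangulations that are quasi-uniform with constant $\sigma$ and all such $\omega,\rho$ the following holds. Counted with multiplicity, $\mathbb D^{-1}\mathbb A$ has $N$ real eigenvalues $\lambda_1\le\dots\le\lambda_N$, and all of them are positive. If $N\ge1$, then $$\kappa(\mathbb D^{-1}\mathbb A):=\frac{\lambda_N}{\lambda_1}\le C\,h^{-2}\,\mathcal J(\omega),$$ and if $m_0<N$, then the $m_0$-th effective condition number satisfies $$\kappa_{m_0}(\mathbb D^{-1}\mathbb A):=\frac{\lambda_N}{\lambda_{m_0+1}}\le C\,h^{-2}.$$ -/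

import Mathlib

open MeasureTheory
open scoped InnerProductSpace Gradient

noncomputable section

namespace JacobiFEM

/-- The Euclidean space `ℝᵈ`. -/
abbrev Space (d : ℕ) : Type := EuclideanSpace ℝ (Fin d)

/-- `(d-1)`-dimensional (Hausdorff) measure on `ℝᵈ`. -/
abbrev surfaceMeasure (d : ℕ) : Measure (Space d) :=
  Measure.hausdorffMeasure ((d : ℝ) - 1)

/-- A (bounded) polygonal / polyhedral domain: a nonempty connected open set which is the interior
of its closure, the closure being a finite union of nondegenerate closed `d`-simplices. -/
structure IsPolyhedralDomain {d : ℕ} (U : Set (Space d)) : Prop where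
  isOpen : IsOpen U
  isConnected : IsConnected U
  interior_closure : interior (closure U) = U
  closure_eq : ∃ F : Set (Finset (Space d)), F.Finite ∧
    (∀ s ∈ F, AffineIndependent ℝ ((↑) : s → Space d) ∧ s.card = d + 1) ∧
    closure U = ⋃ s ∈ F, convexHull ℝ (s : Set (Space d))

/-- The geometric data of the boundary value problem: the polyhedral domain `Ω`, its decomposition
into the non-overlapping polyhedral subdomains `Ω_1, …, Ω_M`, and the Dirichlet part `Γ_D` of the
boundary, which has positive surface measure. -/
structure ModelDomain (d M : ℕ) where
  /-- the domain `Ω` -/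
  Ω : Set (Space d)
  /-- the subdomains `Ω_m` -/
  sub : Fin M → Set (Space d)
  /-- the Dirichlet boundary `Γ_D` -/
  ΓD : Set (Space d)
  polyhedral : IsPolyhedralDomain Ω
  polyhedral_sub : ∀ m, IsPolyhedralDomain (sub m)
  disjoint_sub : Pairwise fun m k => Disjoint (sub m) (sub k)
  closure_eq : closure Ω = ⋃ m, closure (sub m)
  ΓD_subset : ΓD ⊆ frontier Ω
  ΓD_pos : 0 < surfaceMeasure d ΓD

namespace ModelDomain

variable {d M : ℕ} (G : ModelDomain d M)

open Classical in
/-- The index set `I` of the floating subdomains: those with `meas (∂Ω_m ∩ Γ_D) = 0`. -/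
def floating : Finset (Fin M) :=
  Finset.univ.filter fun m => surfaceMeasure d (frontier (G.sub m) ∩ G.ΓD) = 0

/-- The bilinear form `a(u,v) = ∑_m ∫_{Ω_m} ω_m ∇u · ∇v + ∑_m ∫_{Ω_m} ρ_m u v`. It is only applied
to finite element functions, which are affine near almost every point of every `Ω_m`, so that the
pointwise gradient exists almost everywhere and is the weak gradient. -/
def form (ω ρ : Fin M → ℝ) (u v : Space d → ℝ) : ℝ :=
  (∑ m, ∫ x in G.sub m, ω m * ⟪∇ u x, ∇ v x⟫_ℝ) + ∑ m, ∫ x in G.sub m, ρ m * (u x * v x)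

end ModelDomain

/-- A conforming triangulation of `Ω` resolving the subdomains and the Dirichlet boundary. -/
structure Triangulation {d M : ℕ} (G : ModelDomain d M) where
  /-- the underlying simplicial complex; its faces are stored as their finite sets of vertices -/
  K : Geometry.SimplicialComplex ℝ (Space d)
  finite : K.faces.Finite
  /-- every maximal simplex is `d`-dimensional -/
  pure : ∀ s ∈ K.facets, s.card = d + 1
  space_eq : K.space = closure G.Ω
  /-- every subdomain is a union of elements -/
  resolves_sub : ∀ m, closure (G.sub m) =
    ⋃ s ∈ {s ∈ K.facets | convexHull ℝ (s : Set (Space d)) ⊆ closure (G.sub m)},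
      convexHull ℝ (s : Set (Space d))
  /-- the Dirichlet boundary is a union of `(d-1)`-dimensional faces of the triangulation -/
  resolves_ΓD : G.ΓD =
    ⋃ f ∈ {f ∈ K.faces | f.card = d ∧ convexHull ℝ (f : Set (Space d)) ⊆ G.ΓD},
      convexHull ℝ (f : Set (Space d))

namespace Triangulation

variable {d M : ℕ} {G : ModelDomain d M} (T : Triangulation G)

/-- The mesh size `h`: the largest diameter of an element. -/
def meshSize : ℝ :=
  ⨆ s : T.K.facets, Metric.diam (convexHull ℝ ((s : Finset (Space d)) : Set (Space d)))

/-- Quasi-uniformity with constant `σ`: every element contains a ball of radius `σ h`. -/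
def QuasiUniform (σ : ℝ) : Prop :=
  ∀ s ∈ T.K.facets, ∃ x, Metric.ball x (σ * T.meshSize) ⊆ convexHull ℝ (s : Set (Space d))

/-- The linear Lagrange finite element space `V_h`: continuous functions on the closure of `Ω`
which are affine on every simplex of the triangulation and vanish on `Γ_D`. Functions on the closure
of `Ω` are represented by their extension by zero to the whole space. -/
def feSpace : Submodule ℝ (Space d → ℝ) where
  carrier := {u | ContinuousOn u (closure G.Ω) ∧
    (∀ s ∈ T.K.faces, ∃ g : Space d →ᵃ[ℝ] ℝ, Set.EqOn u g (convexHull ℝ (s : Set (Space d)))) ∧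
    (∀ x ∈ G.ΓD, u x = 0) ∧ ∀ x ∉ closure G.Ω, u x = 0}
  zero_mem' := ⟨continuousOn_const, fun _ _ => ⟨0, fun _ _ => rfl⟩, fun _ _ => rfl, fun _ _ => rfl⟩
  add_mem' := by
    rintro u v ⟨hu1, hu2, hu3, hu4⟩ ⟨hv1, hv2, hv3, hv4⟩
    refine ⟨hu1.add hv1, fun s hs => ?_, fun x hx => ?_, fun x hx => ?_⟩
    · obtain ⟨g, hg⟩ := hu2 s hs
      obtain ⟨k, hk⟩ := hv2 s hs
      exact ⟨g + k, fun x hx => by simp [hg hx, hk hx]⟩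
    · simp [hu3 x hx, hv3 x hx]
    · simp [hu4 x hx, hv4 x hx]
  smul_mem' := by
    rintro c u ⟨hu1, hu2, hu3, hu4⟩
    refine ⟨hu1.const_smul c, fun s hs => ?_, fun x hx => ?_, fun x hx => ?_⟩
    · obtain ⟨g, hg⟩ := hu2 s hs
      exact ⟨c • g, fun x hx => by simp [hg hx]⟩
    · simp [hu3 x hx]
    · simp [hu4 x hx]

/-- The degrees of freedom: the vertices of the triangulation not lying on `Γ_D`. -/
abbrev FreeVertex : Type := {p : Space d // p ∈ T.K.vertices ∧ p ∉ G.ΓD}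

instance : Finite T.FreeVertex := by
  have := T.finite.to_subtype
  refine Finite.of_injective (β := T.K.faces) (fun p => ⟨{p.1}, p.2.1⟩) fun p q h => ?_
  exact Subtype.ext (Finset.singleton_injective (congrArg Subtype.val h))

instance : Fintype T.FreeVertex := Fintype.ofFinite _

instance : DecidableEq T.FreeVertex := Classical.decEq _

/-- `w` is the family of barycentric coordinates of `x` with respect to the vertices in `s`. -/
def IsBary (s : Finset (Space d)) (w : Space d → ℝ) (x : Space d) : Prop :=
  (∀ y ∈ s, 0 ≤ w y) ∧ ∑ y ∈ s, w y = 1 ∧ ∑ y ∈ s, w y • y = x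

open Classical in
/-- The hat function at the vertex `p`: at a point of a simplex `s` of the triangulation it is the
barycentric coordinate belonging to `p` (zero if `p` is not a vertex of `s`); it is zero outside the
triangulation. -/
def hat (p x : Space d) : ℝ :=
  if h : ∃ q : Finset (Space d) × (Space d → ℝ), q.1 ∈ T.K.faces ∧ IsBary q.1 q.2 x then
    if p ∈ h.choose.1 then h.choose.2 p else 0
  else 0

theorem map_bary {s : Finset (Space d)} {w : Space d → ℝ} {x : Space d} (h : IsBary s w x)
    (g : Space d →ᵃ[ℝ] ℝ) : g x = ∑ y ∈ s, w y * g y := by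
  have hg : ∀ z, g z = g.linear z + g 0 := fun z => by
    simpa using congrFun (AffineMap.decomp g) z
  obtain ⟨-, h1, rfl⟩ := h
  rw [hg, map_sum]
  have h2 : g 0 = ∑ y ∈ s, w y * g 0 := by rw [← Finset.sum_mul, h1, one_mul]
  nth_rw 1 [h2]
  rw [← Finset.sum_add_distrib]
  refine Finset.sum_congr rfl fun y _ => ?_
  rw [hg y, map_smul, smul_eq_mul]
  ring

open Classical in
theorem exists_coord {s : Finset (Space d)} (hs : s ∈ T.K.faces) (p : Space d) :
    ∃ g : Space d →ᵃ[ℝ] ℝ, ∀ y ∈ s, g y = if y = p then 1 else 0 := by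
  by_cases hp : p ∈ s
  · have hi : AffineIndependent ℝ ((↑) : ((s : Set (Space d)) : Type) → Space d) := T.K.indep hs
    obtain ⟨t, hst, hti, htop⟩ := exists_subset_affineIndependent_affineSpan_eq_top hi
    let b : AffineBasis t ℝ (Space d) := ⟨(↑), hti, by simpa using htop⟩
    refine ⟨b.coord ⟨p, hst hp⟩, fun y hy => ?_⟩
    by_cases hyp : y = p
    · subst hyp
      rw [if_pos rfl]
      exact b.coord_apply_eq ⟨y, hst hy⟩
    · rw [if_neg hyp]
      exact b.coord_apply_ne (i := ⟨p, hst hp⟩) (j := ⟨y, hst hy⟩)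
        fun h => hyp (congrArg Subtype.val h).symm
  · exact ⟨0, fun y hy => by rw [if_neg (by rintro rfl; exact hp hy)]; rfl⟩

open Classical in
theorem coord_eq {s : Finset (Space d)} {w : Space d → ℝ} {x p : Space d} (h : IsBary s w x)
    {g : Space d →ᵃ[ℝ] ℝ} (hg : ∀ y ∈ s, g y = if y = p then 1 else 0) :
    g x = if p ∈ s then w p else 0 := by
  rw [map_bary h g, Finset.sum_congr rfl fun y hy => by rw [hg y hy]]
  simp

theorem exists_bary {s : Finset (Space d)} {x : Space d}
    (hx : x ∈ convexHull ℝ (s : Set (Space d))) : ∃ w, IsBary s w x :=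
  Finset.mem_convexHull'.1 hx

theorem IsBary.mem {s : Finset (Space d)} {w : Space d → ℝ} {x : Space d} (h : IsBary s w x) :
    x ∈ convexHull ℝ (s : Set (Space d)) :=
  Finset.mem_convexHull'.2 ⟨w, h⟩

open Classical in
theorem bary_unique {s t : Finset (Space d)} (hs : s ∈ T.K.faces) (ht : t ∈ T.K.faces)
    {w w' : Space d → ℝ} {x : Space d} (h : IsBary s w x) (h' : IsBary t w' x) (p : Space d) :
    (if p ∈ s then w p else 0) = if p ∈ t then w' p else 0 := by
  have hx := T.K.inter_subset_convexHull hs ht ⟨h.mem, h'.mem⟩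
  rw [← Finset.coe_inter] at hx
  obtain ⟨v, hv⟩ := exists_bary hx
  obtain ⟨g, hg⟩ := T.exists_coord hs p
  obtain ⟨k, hk⟩ := T.exists_coord ht p
  rw [← coord_eq h hg, ← coord_eq h' hk,
    coord_eq hv fun y hy => hg y (Finset.mem_inter.1 hy).1,
    coord_eq hv fun y hy => hk y (Finset.mem_inter.1 hy).2]

open Classical in
theorem hat_eq {s : Finset (Space d)} (hs : s ∈ T.K.faces) {w : Space d → ℝ} {x : Space d}
    (h : IsBary s w x) (p : Space d) : T.hat p x = if p ∈ s then w p else 0 := by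
  have hex : ∃ q : Finset (Space d) × (Space d → ℝ), q.1 ∈ T.K.faces ∧ IsBary q.1 q.2 x :=
    ⟨(s, w), hs, h⟩
  rw [hat, dif_pos hex]
  exact T.bary_unique hex.choose_spec.1 hs hex.choose_spec.2 h p

theorem hat_affine {s : Finset (Space d)} (hs : s ∈ T.K.faces) (p : Space d) :
    ∃ g : Space d →ᵃ[ℝ] ℝ, Set.EqOn (T.hat p) g (convexHull ℝ (s : Set (Space d))) := by
  obtain ⟨g, hg⟩ := T.exists_coord hs p
  refine ⟨g, fun x hx => ?_⟩
  obtain ⟨w, hw⟩ := exists_bary hx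
  rw [T.hat_eq hs hw, coord_eq hw hg]

open Classical in
theorem hat_vertex (p : Space d) {q : Space d} (hq : q ∈ T.K.vertices) :
    T.hat p q = if p = q then 1 else 0 := by
  have h : IsBary {q} (fun _ => 1) q := ⟨by simp, by simp, by simp⟩
  rw [T.hat_eq hq h]
  simp

theorem hat_mem (p : T.FreeVertex) : T.hat p.1 ∈ T.feSpace := by
  refine ⟨?_, fun s hs => T.hat_affine hs p.1, fun x hx => ?_, fun x hx => ?_⟩
  · rw [← T.space_eq]
    have : T.K.space = ⋃ s : T.K.faces, convexHull ℝ ((s : Finset (Space d)) : Set (Space d)) := by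
      rw [Geometry.SimplicialComplex.space, Set.biUnion_eq_iUnion]
    rw [this]
    have := T.finite.to_subtype
    refine (locallyFinite_of_finite _).continuousOn_iUnion
      (fun s => (Set.Finite.isCompact_convexHull (𝕜 := ℝ) s.1.finite_toSet).isClosed) fun s => ?_
    obtain ⟨g, hg⟩ := T.hat_affine s.2 p.1
    exact (AffineMap.continuous_of_finiteDimensional g).continuousOn.congr hg
  · rw [T.resolves_ΓD] at hx
    simp only [Set.mem_iUnion] at hx
    obtain ⟨f, ⟨hf, -, hfD⟩, hxf⟩ := hx
    obtain ⟨w, hw⟩ := exists_bary hxf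
    have hp : p.1 ∉ f := fun hp => p.2.2 (hfD (subset_convexHull ℝ _ hp))
    rw [T.hat_eq hf hw, if_neg hp]
  · rw [hat, dif_neg]
    rintro ⟨q, hq, hw⟩
    exact hx (T.space_eq ▸ T.K.convexHull_subset_space hq hw.mem)

theorem feSpace_ext {u v : Space d → ℝ} (hu : u ∈ T.feSpace) (hv : v ∈ T.feSpace)
    (h : ∀ p : T.FreeVertex, u p.1 = v p.1) : u = v := by
  obtain ⟨-, hu2, hu3, hu4⟩ := hu
  obtain ⟨-, hv2, hv3, hv4⟩ := hv
  funext x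
  by_cases hx : x ∈ closure G.Ω
  · rw [← T.space_eq] at hx
    obtain ⟨s, hs, hxs⟩ := Geometry.SimplicialComplex.mem_space_iff.1 hx
    obtain ⟨g, hg⟩ := hu2 s hs
    obtain ⟨k, hk⟩ := hv2 s hs
    obtain ⟨w, hw⟩ := exists_bary hxs
    rw [hg hxs, hk hxs, map_bary hw, map_bary hw]
    refine Finset.sum_congr rfl fun y hy => ?_
    have hyc := subset_convexHull ℝ (s : Set (Space d)) hy
    rw [← hg hyc, ← hk hyc]
    by_cases hyD : y ∈ G.ΓD
    · rw [hu3 y hyD, hv3 y hyD]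
    · have hyv : y ∈ T.K.vertices := T.K.down_closed hs (Finset.singleton_subset_iff.2 hy)
        (Finset.singleton_nonempty y)
      rw [h ⟨y, hyv, hyD⟩]
  · rw [hu4 x hx, hv4 x hx]

/-- The isomorphism of `V_h` with the space of nodal values. -/
def nodalEquiv : T.feSpace ≃ₗ[ℝ] (T.FreeVertex → ℝ) where
  toFun u p := u.1 p.1
  map_add' _ _ := rfl
  map_smul' _ _ := rfl
  invFun c := ∑ p, c p • ⟨T.hat p.1, T.hat_mem p⟩
  left_inv u := by
    refine Subtype.ext (T.feSpace_ext (Subtype.mem _) u.2 fun q => ?_)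
    simp only [Submodule.coe_sum, Submodule.coe_smul, Finset.sum_apply, Pi.smul_apply, smul_eq_mul]
    rw [Finset.sum_eq_single q]
    · rw [T.hat_vertex _ q.2.1, if_pos rfl, mul_one]
    · intro p _ hpq
      rw [T.hat_vertex _ q.2.1, if_neg fun h => hpq (Subtype.ext h), mul_zero]
    · simp
  right_inv c := by
    funext q
    simp only [Submodule.coe_sum, Submodule.coe_smul, Finset.sum_apply, Pi.smul_apply, smul_eq_mul]
    rw [Finset.sum_eq_single q]
    · rw [T.hat_vertex _ q.2.1, if_pos rfl, mul_one]
    · intro p _ hpq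
      rw [T.hat_vertex _ q.2.1, if_neg fun h => hpq (Subtype.ext h), mul_zero]
    · simp

/-- The nodal basis of `V_h`. -/
def nodalBasis : Module.Basis T.FreeVertex ℝ T.feSpace := Module.Basis.ofEquivFun T.nodalEquiv

/-- The nodal basis consists of the hat functions. -/
theorem nodalBasis_apply (p : T.FreeVertex) : (T.nodalBasis p : Space d → ℝ) = T.hat p.1 := by
  refine T.feSpace_ext (Subtype.mem _) (T.hat_mem p) fun q => ?_
  have h : T.nodalEquiv (T.nodalBasis p) q = (Pi.single p 1 : T.FreeVertex → ℝ) q := by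
    rw [nodalBasis, Module.Basis.coe_ofEquivFun, LinearEquiv.apply_symm_apply]
  refine h.trans ?_
  rw [T.hat_vertex _ q.2.1, Pi.single_apply]
  exact if_congr (by rw [eq_comm]; exact Subtype.ext_iff) rfl rfl

/-- The dimension `N` of `V_h`. -/
def numDofs : ℕ := Fintype.card T.FreeVertex

/-- The stiffness matrix `a_{ij} = a(φ_j, φ_i)`. -/
def stiffness (ω ρ : Fin M → ℝ) : Matrix T.FreeVertex T.FreeVertex ℝ :=
  Matrix.of fun i j => G.form ω ρ (T.nodalBasis j).1 (T.nodalBasis i).1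

/-- The Jacobi preconditioned matrix `D⁻¹ A`, where `D` is the diagonal of the stiffness matrix. -/
def jacobi (ω ρ : Fin M → ℝ) : Matrix T.FreeVertex T.FreeVertex ℝ :=
  (Matrix.diagonal (T.stiffness ω ρ).diag)⁻¹ * T.stiffness ω ρ

end Triangulation

/-- The real eigenvalues of a matrix in increasing order, repeated according to multiplicity. -/
def sortedEigenvalues {ι : Type*} [Fintype ι] [DecidableEq ι] (B : Matrix ι ι ℝ) : List ℝ :=
  B.charpoly.roots.sort (· ≤ ·)

/-- The `k`-th smallest eigenvalue `λ_k`, `1 ≤ k ≤ N`. -/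
def eigenvalue {ι : Type*} [Fintype ι] [DecidableEq ι] (B : Matrix ι ι ℝ) (k : ℕ) : ℝ :=
  (sortedEigenvalues B).getD (k - 1) 0

/-- The `m`-th effective condition number `λ_N / λ_{m+1}`, for `0 ≤ m < N`. -/
def effCondNumber {ι : Type*} [Fintype ι] [DecidableEq ι] (m : ℕ) (B : Matrix ι ι ℝ) : ℝ :=
  eigenvalue B (Fintype.card ι) / eigenvalue B (m + 1)

/-- The condition number `λ_N / λ_1`. -/
def condNumber {ι : Type*} [Fintype ι] [DecidableEq ι] (B : Matrix ι ι ℝ) : ℝ :=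
  eigenvalue B (Fintype.card ι) / eigenvalue B 1

/-- The jump `J(ω) = max ω / min ω`. -/
def jump {M : ℕ} (ω : Fin M → ℝ) : ℝ := (⨆ m, ω m) / ⨅ m, ω m

end JacobiFEM

end

/-! With `D` the diagonal of `A`, the matrix `D⁻¹A` has the characteristic polynomial of the
symmetric matrix `D^{-1/2} A D^{-1/2}`. Its eigenvalues are therefore real and are governed by the
quotient of `a(u,u)` by `∑ a(φ_p,φ_p) u(p)²`, where `u` has nodal values `u(p)`. The variational
bounds are `eigenvalue_le` and `le_eigenvalue`; the rest compares numerator and denominator.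

Upper bound. Inside an element at most `d + 1` hat functions are nonzero, so Cauchy-Schwarz gives
`λ_N ≤ d + 1` for every mesh and all coefficients (`dotProduct_stiffness_le`).

Lower bound. Gradients of hat functions are at most `2/(σh)`, and the nodal values on an element are
controlled by the mass of `u` there. Hence the denominator is at most a constant times `h⁻² ∑ ω_m
‖u‖²_{Ω_m} + ∑ ρ_m ‖u‖²_{Ω_m}` (`sum_diag_le`), and the `ω`-weighted mass has to be bounded by the
`ω`-weighted energy. If `u` has mean zero on every floating subdomain, Poincaré's inequality on
these and Friedrichs' inequality on the others hold on each `Ω_m` separately, so no jump of `ω`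
enters. The mean value conditions are `m₀` linear constraints, and Courant-Fischer bounds `λ_{m₀+1}`
below by a multiple of `h²`. Without constraints, Friedrichs' inequality on all of `Ω` is used;
passing through `max ω` and `min ω` costs the factor `J(ω)` in the bound for `λ_1`.

The constants must not depend on the mesh. The Poincaré inequality is therefore derived for any
function with a square-integral bound along segments: on convex sets by integrating over segments,
on polyhedral domains by chaining balls through the connected open set
(`IsPolyhedralDomain.linked`). For Friedrichs' inequality one Dirichlet face of one reference
triangulation is fixed; functions of every other finite element space vanish on it too
(`friedrichs_of_face`). -/

namespace JacobiFEM

/-! ### Eigenvalues of the Jacobi preconditioned matrix via quadratic forms -/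

section LinearAlgebra

open Matrix

variable {ι : Type*} [Fintype ι] [DecidableEq ι]

/-- The symmetrically scaled matrix `D^{-1/2} A D^{-1/2}` attached to a matrix `A` with
diagonal `D`. -/
noncomputable def symScaled (A : Matrix ι ι ℝ) : Matrix ι ι ℝ :=
  diagonal (fun i => (√(A i i))⁻¹) * A * diagonal fun i => (√(A i i))⁻¹

theorem symScaled_isHermitian {A : Matrix ι ι ℝ} (hA : A.IsHermitian) :
    (symScaled A).IsHermitian := by
  have h := isHermitian_mul_mul_conjTranspose (diagonal fun i => (√(A i i))⁻¹) hA
  simpa [symScaled, diagonal_conjTranspose] using h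

/-- Split `D⁻¹` as `D^{-1/2} D^{-1/2}` and use that `XY` and `YX` have the same characteristic
polynomial. This transfers the spectrum with multiplicities. -/
theorem charpoly_diag_inv_mul {A : Matrix ι ι ℝ} (hD : ∀ i, 0 < A i i) :
    ((diagonal A.diag)⁻¹ * A).charpoly = (symScaled A).charpoly := by
  have h1 : (diagonal A.diag)⁻¹ =
      diagonal (fun i => (√(A i i))⁻¹) * diagonal (fun i => (√(A i i))⁻¹) := by
    refine inv_eq_left_inv ?_
    rw [diagonal_mul_diagonal, diagonal_mul_diagonal, ← diagonal_one]
    congr 1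
    funext i
    have := Real.sqrt_pos.2 (hD i)
    have h2 := Real.mul_self_sqrt (hD i).le
    simp only [diag_apply]
    field_simp
    nlinarith
  rw [h1, mul_assoc, charpoly_mul_comm, symScaled]

theorem symScaled_quad {A : Matrix ι ι ℝ} (v : ι → ℝ) :
    v ⬝ᵥ (symScaled A *ᵥ v) =
      (fun i => (√(A i i))⁻¹ * v i) ⬝ᵥ (A *ᵥ fun i => (√(A i i))⁻¹ * v i) := by
  have h : (diagonal fun i => (√(A i i))⁻¹) *ᵥ v = fun i => (√(A i i))⁻¹ * v i := by
    funext i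
    rw [mulVec_diagonal]
  rw [symScaled, ← mulVec_mulVec, ← mulVec_mulVec, h, dotProduct_mulVec]
  congr 1
  funext i
  rw [vecMul_diagonal, mul_comm]

theorem sortedEigenvalues_eq {A : Matrix ι ι ℝ} (hA : A.IsHermitian) (hD : ∀ i, 0 < A i i) :
    sortedEigenvalues ((diagonal A.diag)⁻¹ * A) =
      (Finset.univ.val.map (symScaled_isHermitian hA).eigenvalues).sort (· ≤ ·) := by
  rw [sortedEigenvalues, charpoly_diag_inv_mul hD,
    (symScaled_isHermitian hA).roots_charpoly_eq_eigenvalues]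
  rfl

theorem length_sortedEigenvalues {A : Matrix ι ι ℝ} (hA : A.IsHermitian) (hD : ∀ i, 0 < A i i) :
    (sortedEigenvalues ((diagonal A.diag)⁻¹ * A)).length = Fintype.card ι := by
  rw [sortedEigenvalues_eq hA hD]
  simp

theorem sum_diag_scaled {ι : Type*} [Fintype ι] {A : Matrix ι ι ℝ} (hD : ∀ i, 0 < A i i) (v : ι → ℝ) :
    ∑ i, A i i * ((√(A i i))⁻¹ * v i) ^ 2 = ∑ i, v i ^ 2 := by
  refine Finset.sum_congr rfl fun i _ => ?_
  have h2 := Real.sq_sqrt (hD i).le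
  have := Real.sqrt_pos.2 (hD i)
  rw [mul_pow, inv_pow, h2]
  have := (hD i).ne'
  field_simp

/-- A unit eigenvector `v` of the scaled matrix corresponds to `x = D^{-1/2} v`; the weighted sum of
squares of `x` is then `1`, and the eigenvalue is the value of the form of `A` at `x`. -/
theorem eigenvalue_le {A : Matrix ι ι ℝ} (hA : A.IsHermitian) (hD : ∀ i, 0 < A i i) {Λ : ℝ}
    (h : ∀ x : ι → ℝ, x ⬝ᵥ (A *ᵥ x) ≤ Λ * ∑ i, A i i * x i ^ 2) {k : ℕ} (hk : 1 ≤ k)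
    (hk' : k ≤ Fintype.card ι) :
    eigenvalue ((diagonal A.diag)⁻¹ * A) k ≤ Λ := by
  have hl := length_sortedEigenvalues hA hD
  -- The index lies inside the list, so the default value `0` in the definition of `eigenvalue` is
  -- never taken.
  have hlt : k - 1 < (sortedEigenvalues ((diagonal A.diag)⁻¹ * A)).length := by omega
  rw [eigenvalue, List.getD_eq_getElem _ _ hlt]
  have hmem := List.getElem_mem hlt
  nth_rw 1 [sortedEigenvalues_eq hA hD] at hmem
  simp only [Multiset.mem_sort, Multiset.mem_map, Finset.mem_val, Finset.mem_univ, true_and] at hmem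
  obtain ⟨i, hi⟩ := hmem
  rw [← hi, (symScaled_isHermitian hA).eigenvalues_eq]
  set v := (symScaled_isHermitian hA).eigenvectorBasis i with hv
  have h1 : ∑ j, v j ^ 2 = 1 := by
    have := (symScaled_isHermitian hA).eigenvectorBasis.orthonormal.1 i
    rw [← hv, EuclideanSpace.norm_eq] at this
    simpa using this
  have h2 := h fun j => (√(A j j))⁻¹ * v j
  rw [← symScaled_quad, sum_diag_scaled hD, h1, mul_one] at h2
  simpa using h2

/-- This is one half of the Courant-Fischer principle. If the `k`-th eigenvalue were below `c`, the
eigenvectors with eigenvalue below `c` would span a space of dimension at least `k`, too large for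
the constraints `F` to be injective on it. A nonzero vector in the kernel contradicts the lower
bound. -/
theorem le_eigenvalue {A : Matrix ι ι ℝ} (hA : A.IsHermitian) (hD : ∀ i, 0 < A i i)
    {κ : Type*} [Fintype κ] (F : (ι → ℝ) →ₗ[ℝ] (κ → ℝ)) {c : ℝ}
    (h : ∀ x : ι → ℝ, F x = 0 → c * ∑ i, A i i * x i ^ 2 ≤ x ⬝ᵥ (A *ᵥ x)) {k : ℕ}
    (hk : Fintype.card κ < k) (hk' : k ≤ Fintype.card ι) :
    c ≤ eigenvalue ((diagonal A.diag)⁻¹ * A) k := by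
  classical
  set hS := symScaled_isHermitian hA
  have hl := length_sortedEigenvalues hA hD
  have hlt : k - 1 < (sortedEigenvalues ((diagonal A.diag)⁻¹ * A)).length := by omega
  rw [eigenvalue, List.getD_eq_getElem _ _ hlt]
  by_contra! hlt'
  set l := sortedEigenvalues ((diagonal A.diag)⁻¹ * A) with hldef
  have hle := sortedEigenvalues_eq hA hD
  have hsorted : l.Pairwise (· ≤ ·) := by
    rw [hldef, sortedEigenvalues]
    exact Multiset.pairwise_sort _ _
  -- at least `k` eigenvalues are smaller than `c`
  have hcount : k ≤ l.countP (· < c) := by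
    have h1 : (l.take k).countP (· < c) = (l.take k).length := by
      rw [List.countP_eq_length]
      intro a ha
      obtain ⟨j, hj, rfl⟩ := List.getElem_of_mem ha
      rw [List.length_take] at hj
      simp only [List.getElem_take, decide_eq_true_eq]
      rcases Nat.lt_or_ge j (k - 1) with hj' | hj'
      · exact (List.pairwise_iff_getElem.1 hsorted j (k - 1) (by omega) hlt hj').trans_lt hlt'
      · have : j = k - 1 := by omega
        subst this
        exact hlt'
    have h2 : (l.take k).countP (· < c) ≤ l.countP (· < c) :=
      (List.take_sublist _ _).countP_le
    rw [h1, List.length_take] at h2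
    omega
  have hcard : k ≤ Fintype.card {i // hS.eigenvalues i < c} := by
    refine hcount.trans_eq ?_
    rw [← Multiset.coe_countP, hldef, hle, Multiset.sort_eq, Multiset.countP_map, Fintype.card_subtype]
    rfl
  let J := {i // hS.eigenvalues i < c}
  let V : (J → ℝ) →ₗ[ℝ] (ι → ℝ) :=
    Fintype.linearCombination ℝ fun j : J => ((hS.eigenvectorBasis j.1 : EuclideanSpace ℝ ι) : ι → ℝ)
  let S : (ι → ℝ) →ₗ[ℝ] (ι → ℝ) := (diagonal fun i => (√(A i i))⁻¹).mulVecLin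
  -- `V` combines the eigenvectors below `c` and `S` is `D^{-1/2}`; the source has dimension at
  -- least `k`, the target has dimension `card κ < k`.
  have hker : (F ∘ₗ S ∘ₗ V).ker ≠ ⊥ := by
    refine LinearMap.ker_ne_bot_of_finrank_lt ?_
    simp only [Module.finrank_fintype_fun_eq_card]
    exact hk.trans_le hcard
  obtain ⟨a, ha, ha0⟩ := Submodule.exists_mem_ne_zero_of_ne_bot hker
  rw [LinearMap.mem_ker, LinearMap.comp_apply, LinearMap.comp_apply] at ha
  have hSV : S (V a) = fun i => (√(A i i))⁻¹ * V a i := by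
    funext i
    simp only [S, mulVecLin_apply, mulVec_diagonal]
  have h1 := h _ ha
  rw [hSV, sum_diag_scaled hD, ← symScaled_quad] at h1
  have hV : V a = WithLp.ofLp (∑ j : J, a j • hS.eigenvectorBasis j.1) := by
    simp [V, Fintype.linearCombination_apply, WithLp.ofLp_sum]
  have horth : Orthonormal ℝ fun j : J => hS.eigenvectorBasis j.1 :=
    hS.eigenvectorBasis.orthonormal.comp _ Subtype.val_injective
  have hnorm : ∑ i, V a i ^ 2 = ∑ j, a j ^ 2 := by
    have h2 := horth.inner_sum a a Finset.univ
    rw [hV, EuclideanSpace.inner_eq_star_dotProduct] at *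
    simpa [dotProduct, sq] using h2
  have hquad : V a ⬝ᵥ (symScaled A *ᵥ V a) = ∑ j : J, hS.eigenvalues j.1 * a j ^ 2 := by
    have h3 : symScaled A *ᵥ V a =
        WithLp.ofLp (∑ j : J, (hS.eigenvalues j.1 * a j) • hS.eigenvectorBasis j.1) := by
      rw [hV, WithLp.ofLp_sum, WithLp.ofLp_sum, mulVec_sum]
      refine Finset.sum_congr rfl fun j _ => ?_
      rw [WithLp.ofLp_smul, mulVec_smul, hS.mulVec_eigenvectorBasis, WithLp.ofLp_smul, smul_smul,
        mul_comm]
    have h2 := horth.inner_sum (fun j => hS.eigenvalues j.1 * a j) a Finset.univ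
    rw [h3, hV]
    rw [EuclideanSpace.inner_eq_star_dotProduct] at h2
    simpa [sq, mul_assoc] using h2
  rw [hnorm, hquad, Finset.mul_sum] at h1
  -- Now `h1` reads `∑ c aⱼ² ≤ ∑ λⱼ aⱼ²` with every `λⱼ < c`, which fails as soon as one coefficient
  -- is nonzero.
  obtain ⟨j, hj⟩ := Function.ne_iff.1 ha0
  refine absurd h1 (not_le.2 (Finset.sum_lt_sum (fun i _ => ?_) ⟨j, Finset.mem_univ _, ?_⟩))
  · exact mul_le_mul_of_nonneg_right i.2.le (sq_nonneg _)
  · exact mul_lt_mul_of_pos_right j.2 (sq_pos_of_ne_zero hj)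

end LinearAlgebra

/-! ### Mean oscillation bounds along segments -/

section Poincare

open scoped ENNReal

variable {d : ℕ}

/-- `g` controls the squared increments of `u` along the line segments contained in `S`. -/
structure IsSqUpperGradient (S : Set (Space d)) (u : Space d → ℝ) (g : Space d → ℝ≥0∞) :
    Prop where
  measurable_fun : Measurable u
  measurable_grad : Measurable g
  le : ∀ (x v : Space d) (a : ℝ), 0 ≤ a → (∀ t ∈ Set.Icc 0 a, x + t • v ∈ S) →
    ‖u (x + a • v) - u x‖ₑ ^ 2 ≤
      ENNReal.ofReal a * ‖v‖ₑ ^ 2 * ∫⁻ t in Set.Icc 0 a, g (x + t • v)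

/-- The mean square of the difference of the values on `V` and on `W` is controlled by the
upper gradient on `S`. -/
def Linked (S V W : Set (Space d)) : Prop :=
  ∃ C : ℝ≥0∞, C ≠ ∞ ∧ ∀ u g, IsSqUpperGradient S u g →
    ∫⁻ x in V, ∫⁻ y in W, ‖u x - u y‖ₑ ^ 2 ≤ C * ∫⁻ x in S, g x

theorem lintegral_add_smul {h : Space d → ℝ≥0∞} (hh : Measurable h) (z : Space d) {t : ℝ}
    (ht : 0 < t) :
    ∫⁻ y, h (z + t • y) = ENNReal.ofReal ((t ^ d)⁻¹) * ∫⁻ y, h y := by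
  have h1 : ∫⁻ y, h (z + t • y) = ∫⁻ y, h (z + y) ∂(Measure.map (t • ·) volume) := by
    rw [lintegral_map (by fun_prop) (by fun_prop)]
  rw [h1, Measure.map_addHaar_smul _ ht.ne', lintegral_smul_measure, smul_eq_mul,
    lintegral_add_left_eq_self h z, finrank_euclideanSpace_fin, abs_of_pos (by positivity)]

/-- The contraction by `t` towards `x` maps the convex set `U` into itself, and its inverse Jacobian
`t^{-d}` is at most `2^d` for `t ≥ 1/2`. -/
theorem setLIntegral_contract_le {U : Set (Space d)} (hU : Convex ℝ U) (hUm : MeasurableSet U)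
    {g : Space d → ℝ≥0∞} (hg : Measurable g) {x : Space d} (hx : x ∈ U) {t : ℝ} (ht : 1 / 2 ≤ t)
    (ht1 : t ≤ 1) :
    ∫⁻ y in U, g (x + t • (y - x)) ≤ 2 ^ d * ∫⁻ y in U, g y := by
  have h1 : ∫⁻ y in U, g (x + t • (y - x)) ≤ ∫⁻ y, U.indicator g ((x - t • x) + t • y) := by
    rw [← lintegral_indicator hUm]
    refine lintegral_mono fun y => Set.indicator_apply_le' (fun hy => ?_) fun _ => zero_le
    have h2 : x - t • x + t • y = x + t • (y - x) := by rw [smul_sub]; abel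
    have h3 : x + t • (y - x) ∈ U := hU.add_smul_sub_mem hx hy ⟨by linarith, ht1⟩
    rw [h2, Set.indicator_of_mem h3]
  refine h1.trans ?_
  rw [lintegral_add_smul (hg.indicator hUm) _ (by linarith), lintegral_indicator hUm]
  gcongr
  have h4 : (t ^ d)⁻¹ ≤ 2 ^ d := by
    rw [← inv_pow]
    refine pow_le_pow_left₀ (by positivity) ?_ d
    rw [inv_le_comm₀ (by linarith) (by norm_num)]
    linarith
  refine (ENNReal.ofReal_le_ofReal h4).trans_eq ?_
  rw [ENNReal.ofReal_pow (by norm_num)]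
  norm_num

/-- For each fixed `t`, the substitution is made in whichever endpoint carries weight at least
`1/2`, which avoids the singular Jacobian at `t = 0`. -/
theorem lintegral_segments_le {U : Set (Space d)} (hU : Convex ℝ U) (hUm : MeasurableSet U)
    {g : Space d → ℝ≥0∞} (hg : Measurable g) :
    ∫⁻ x in U, ∫⁻ y in U, ∫⁻ t in Set.Icc (0 : ℝ) 1, g (x + t • (y - x)) ≤
      2 ^ d * volume U * ∫⁻ x in U, g x := by
  have h1 : ∀ x : Space d, ∫⁻ y in U, ∫⁻ t in Set.Icc (0 : ℝ) 1, g (x + t • (y - x)) =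
      ∫⁻ t in Set.Icc (0 : ℝ) 1, ∫⁻ y in U, g (x + t • (y - x)) := fun x =>
    lintegral_lintegral_swap (Measurable.aemeasurable (hg.comp (by fun_prop)))
  simp_rw [h1]
  rw [lintegral_lintegral_swap]
  swap
  · refine Measurable.aemeasurable ?_
    refine Measurable.lintegral_prod_right' (f := fun q : (Space d × ℝ) × Space d =>
      g (q.1.1 + q.1.2 • (q.2 - q.1.1))) (hg.comp (by fun_prop))
  have h2 : ∀ t ∈ Set.Icc (0 : ℝ) 1, ∫⁻ x in U, ∫⁻ y in U, g (x + t • (y - x)) ≤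
      2 ^ d * volume U * ∫⁻ x in U, g x := by
    have h3 : ∀ t ∈ Set.Icc (1 / 2 : ℝ) 1, ∫⁻ x in U, ∫⁻ y in U, g (x + t • (y - x)) ≤
        2 ^ d * volume U * ∫⁻ x in U, g x := by
      intro t ht
      calc ∫⁻ x in U, ∫⁻ y in U, g (x + t • (y - x))
          ≤ ∫⁻ x in U, 2 ^ d * ∫⁻ y in U, g y :=
            setLIntegral_mono' hUm fun x hx => setLIntegral_contract_le hU hUm hg hx ht.1 ht.2
        _ = _ := by rw [setLIntegral_const]; ring
    intro t ht
    rcases le_total (1 / 2) t with h | h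
    · exact h3 t ⟨h, ht.2⟩
    -- For `t ≤ 1/2`, exchanging `x` and `y` turns the parameter into `1 - t ≥ 1/2`.
    · have hm' : Measurable (Function.uncurry fun x y : Space d => g (x + t • (y - x))) :=
        hg.comp (g := g) (f := fun p : Space d × Space d => p.1 + t • (p.2 - p.1)) (by fun_prop)
      rw [lintegral_lintegral_swap hm'.aemeasurable]
      refine le_of_eq_of_le ?_ (h3 (1 - t) ⟨by linarith, by linarith [ht.1]⟩)
      refine lintegral_congr fun x => lintegral_congr fun y => congrArg g ?_
      rw [sub_smul, one_smul, smul_sub, smul_sub]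
      abel
  calc _ ≤ ∫⁻ t in Set.Icc (0 : ℝ) 1, 2 ^ d * volume U * ∫⁻ x in U, g x :=
        setLIntegral_mono' measurableSet_Icc h2
    _ = _ := by simp

/-- Apply the upper gradient along the segment from `x` to `y`, whose length is at most `2R`, and
average over all pairs. -/
theorem linked_self_of_convex {S U : Set (Space d)} (hU : Convex ℝ U) (hUm : MeasurableSet U)
    (hUb : Bornology.IsBounded U) (hUS : U ⊆ S) : Linked S U U := by
  obtain ⟨R, hR⟩ := hUb.exists_norm_le
  refine ⟨(2 * ENNReal.ofReal R) ^ 2 * (2 ^ d * volume U), ?_, fun u g hug => ?_⟩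
  · have := hUb.measure_lt_top (μ := volume)
    finiteness
  calc ∫⁻ x in U, ∫⁻ y in U, ‖u x - u y‖ₑ ^ 2
      ≤ ∫⁻ x in U, ∫⁻ y in U, (2 * ENNReal.ofReal R) ^ 2 *
          ∫⁻ t in Set.Icc (0 : ℝ) 1, g (x + t • (y - x)) := by
        refine setLIntegral_mono' hUm fun x hx => setLIntegral_mono' hUm fun y hy => ?_
        have h := hug.le x (y - x) 1 zero_le_one fun t ht =>
          hUS (hU.add_smul_sub_mem hx hy ht)
        rw [one_smul, add_sub_cancel, ENNReal.ofReal_one, one_mul] at h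
        rw [← enorm_neg, neg_sub]
        refine h.trans ?_
        gcongr
        rw [two_mul]
        refine (enorm_sub_le).trans (add_le_add ?_ ?_) <;>
          rw [← ofReal_norm] <;> exact ENNReal.ofReal_le_ofReal (hR _ ‹_›)
    _ = (2 * ENNReal.ofReal R) ^ 2 *
          ∫⁻ x in U, ∫⁻ y in U, ∫⁻ t in Set.Icc (0 : ℝ) 1, g (x + t • (y - x)) := by
        have hfin : (2 * ENNReal.ofReal R) ^ 2 ≠ ∞ := by finiteness
        simp_rw [lintegral_const_mul' _ _ hfin]
    _ ≤ (2 * ENNReal.ofReal R) ^ 2 * (2 ^ d * volume U * ∫⁻ x in U, g x) := by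
        gcongr
        exact lintegral_segments_le hU hUm hug.measurable_grad
    _ ≤ (2 * ENNReal.ofReal R) ^ 2 * (2 ^ d * volume U * ∫⁻ x in S, g x) := by
        gcongr
    _ = _ := by ring

theorem Linked.symm {S V W : Set (Space d)} (h : Linked S V W) : Linked S W V := by
  obtain ⟨C, hC, h⟩ := h
  refine ⟨C, hC, fun u g hug => ?_⟩
  rw [lintegral_lintegral_swap]
  · refine le_of_eq_of_le ?_ (h u g hug)
    refine lintegral_congr fun x => lintegral_congr fun y => ?_
    rw [← enorm_neg, neg_sub]
  · have := hug.measurable_fun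
    fun_prop

theorem Linked.mono {S V W V' W' : Set (Space d)} (h : Linked S V W) (hV : V' ⊆ V) (hW : W' ⊆ W) :
    Linked S V' W' := by
  obtain ⟨C, hC, h⟩ := h
  refine ⟨C, hC, fun u g hug => le_trans ?_ (h u g hug)⟩
  exact (lintegral_mono_set hV).trans (lintegral_mono fun x => lintegral_mono_set hW)

theorem enorm_sub_sq_le (a b c : ℝ) :
    ‖a - b‖ₑ ^ 2 ≤ 2 * ‖a - c‖ₑ ^ 2 + 2 * ‖c - b‖ₑ ^ 2 := by
  have h : (a - b) ^ 2 ≤ 2 * (a - c) ^ 2 + 2 * (c - b) ^ 2 := by nlinarith [sq_nonneg (a - 2 * c + b)]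
  have h2 : ∀ r : ℝ, ‖r‖ₑ ^ 2 = ENNReal.ofReal (r ^ 2) := fun r => by
    rw [Real.enorm_eq_ofReal_abs, ← ENNReal.ofReal_pow (abs_nonneg r), sq_abs]
  rw [h2, h2, h2, ← ENNReal.ofReal_ofNat, ← ENNReal.ofReal_mul (by norm_num),
    ← ENNReal.ofReal_mul (by norm_num), ← ENNReal.ofReal_add (by positivity) (by positivity)]
  exact ENNReal.ofReal_le_ofReal h

/-- Insert an intermediate value `u z`, average over `z ∈ B` and divide by the volume of `B`. This
is why `B` needs positive finite measure. -/
theorem Linked.trans {S V B W : Set (Space d)} (h1 : Linked S V B) (h2 : Linked S B W)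
    (hB : volume B ≠ 0) (hB' : volume B ≠ ∞) (hV : volume V ≠ ∞) (hW : volume W ≠ ∞) :
    Linked S V W := by
  obtain ⟨C1, hC1, h1⟩ := h1
  obtain ⟨C2, hC2, h2⟩ := h2
  refine ⟨(volume B)⁻¹ * (volume W * 2 * C1 + volume V * 2 * C2), ?_, fun u g hug => ?_⟩
  · have : (volume B)⁻¹ ≠ ∞ := ENNReal.inv_ne_top.2 hB
    finiteness
  have hu := hug.measurable_fun
  have key : volume B * ∫⁻ x in V, ∫⁻ y in W, ‖u x - u y‖ₑ ^ 2 ≤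
      (volume W * 2 * C1 + volume V * 2 * C2) * ∫⁻ x in S, g x := by
    calc volume B * ∫⁻ x in V, ∫⁻ y in W, ‖u x - u y‖ₑ ^ 2
        = ∫⁻ x in V, ∫⁻ y in W, ∫⁻ _z in B, ‖u x - u y‖ₑ ^ 2 := by
          simp_rw [setLIntegral_const, lintegral_mul_const' _ _ hB', mul_comm]
      _ ≤ ∫⁻ x in V, ∫⁻ y in W, ∫⁻ z in B, (2 * ‖u x - u z‖ₑ ^ 2 + 2 * ‖u z - u y‖ₑ ^ 2) :=
          lintegral_mono fun x => lintegral_mono fun y => lintegral_mono fun z =>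
            enorm_sub_sq_le _ _ _
      _ = ∫⁻ x in V, ∫⁻ y in W, ((2 * ∫⁻ z in B, ‖u x - u z‖ₑ ^ 2) +
            2 * ∫⁻ z in B, ‖u z - u y‖ₑ ^ 2) := by
          refine lintegral_congr fun x => lintegral_congr fun y => ?_
          rw [lintegral_add_left (by fun_prop), lintegral_const_mul' _ _ (by norm_num),
            lintegral_const_mul' _ _ (by norm_num)]
      _ = ∫⁻ x in V, (volume W * (2 * ∫⁻ z in B, ‖u x - u z‖ₑ ^ 2) +
            2 * ∫⁻ z in B, ∫⁻ y in W, ‖u z - u y‖ₑ ^ 2) := by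
          refine lintegral_congr fun x => ?_
          rw [lintegral_add_left (by fun_prop), setLIntegral_const, mul_comm,
            lintegral_const_mul' _ _ (by norm_num), lintegral_lintegral_swap (by fun_prop)]
      _ = volume W * 2 * (∫⁻ x in V, ∫⁻ z in B, ‖u x - u z‖ₑ ^ 2) +
            volume V * 2 * ∫⁻ z in B, ∫⁻ y in W, ‖u z - u y‖ₑ ^ 2 := by
          rw [lintegral_add_right _ (by fun_prop), setLIntegral_const,
            lintegral_const_mul' _ _ hW, lintegral_const_mul' _ _ (by norm_num)]
          ring
      _ ≤ volume W * 2 * (C1 * ∫⁻ x in S, g x) + volume V * 2 * (C2 * ∫⁻ x in S, g x) := by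
          gcongr
          · exact h1 u g hug
          · exact h2 u g hug
      _ = _ := by ring
  rw [mul_assoc, ← ENNReal.div_eq_inv_mul, ENNReal.le_div_iff_mul_le (Or.inl hB) (Or.inl hB'),
    mul_comm]
  exact key

theorem linked_biUnion {ι : Type*} {S : Set (Space d)} (F : Finset ι) (V : ι → Set (Space d))
    {W : Set (Space d)} (h : ∀ i ∈ F, Linked S (V i) W) : Linked S (⋃ i ∈ F, V i) W := by
  classical
  induction F using Finset.induction_on with
  | empty => exact ⟨0, by simp, fun u g _ => by simp⟩
  | insert a F _ ih =>
    obtain ⟨C1, hC1, h1⟩ := h a (Finset.mem_insert_self _ _)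
    obtain ⟨C2, hC2, h2⟩ := ih fun i hi => h i (Finset.mem_insert_of_mem hi)
    refine ⟨C1 + C2, by finiteness, fun u g hug => ?_⟩
    rw [Finset.set_biUnion_insert, add_mul]
    exact (lintegral_union_le _ _ _).trans (add_le_add (h1 u g hug) (h2 u g hug))

theorem Linked.congr_ae {S V W V' W' : Set (Space d)} (h : Linked S V W)
    (hV : V ≤ᵐ[volume] V') (hV' : V' ≤ᵐ[volume] V) (hW : W ≤ᵐ[volume] W')
    (hW' : W' ≤ᵐ[volume] W) : Linked S V' W' := by
  obtain ⟨C, hC, h⟩ := h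
  refine ⟨C, hC, fun u g hug => ?_⟩
  rw [Measure.restrict_congr_set (hV'.antisymm hV), Measure.restrict_congr_set (hW'.antisymm hW)]
  exact h u g hug

end Poincare

/-! ### Poincaré and Friedrichs inequalities on polyhedral domains -/

section Polyhedral

open scoped ENNReal

variable {d : ℕ}

theorem convex_interior_ae_eq {U : Set (Space d)} (hU : Convex ℝ U) :
    U ≤ᵐ[volume] interior U := by
  rw [ae_le_set]
  exact measure_mono_null (Set.sdiff_subset_sdiff_left subset_closure) (hU.addHaar_frontier volume)

theorem interior_convexHull_simplex_nonempty {s : Finset (Space d)}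
    (hs : AffineIndependent ℝ ((↑) : s → Space d)) (hc : s.card = d + 1) :
    (interior (convexHull ℝ (s : Set (Space d)))).Nonempty := by
  rw [interior_convexHull_nonempty_iff_affineSpan_eq_top]
  have h := hs.affineSpan_eq_top_iff_card_eq_finrank_add_one.2 (by simp [hc])
  simpa using h

theorem isBounded_convexHull_finset (s : Finset (Space d)) :
    Bornology.IsBounded (convexHull ℝ (s : Set (Space d))) :=
  isBounded_convexHull.2 s.finite_toSet.isBounded

theorem isCompact_convexHull_finset (s : Finset (Space d)) :
    IsCompact (convexHull ℝ (s : Set (Space d))) :=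
  s.finite_toSet.isCompact_convexHull ℝ

namespace IsPolyhedralDomain

variable {U : Set (Space d)}

theorem isBounded_closure (hU : IsPolyhedralDomain U) : Bornology.IsBounded (closure U) := by
  obtain ⟨F, hF, -, h⟩ := hU.closure_eq
  rw [h, Bornology.isBounded_biUnion hF]
  exact fun s _ => isBounded_convexHull_finset s

theorem isBounded (hU : IsPolyhedralDomain U) : Bornology.IsBounded U :=
  hU.isBounded_closure.subset subset_closure

theorem volume_ne_top (hU : IsPolyhedralDomain U) : volume U ≠ ∞ :=
  hU.isBounded.measure_lt_top.ne

theorem volume_ne_zero (hU : IsPolyhedralDomain U) : volume U ≠ 0 :=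
  (hU.isOpen.measure_pos volume hU.isConnected.nonempty).ne'

/-- The interior of each simplex lies in `interior (closure U) = U`. So `closure U \ U` is covered
by finitely many boundaries of convex sets, which are null. -/
theorem closure_ae_eq (hU : IsPolyhedralDomain U) : closure U =ᵐ[volume] U := by
  refine Filter.EventuallyLE.antisymm ?_ (Filter.Eventually.of_forall subset_closure)
  obtain ⟨F, hF, -, h⟩ := hU.closure_eq
  rw [ae_le_set]
  refine measure_mono_null ?_
    ((measure_biUnion_null_iff hF.countable (μ := volume)
      (s := fun s => frontier (convexHull ℝ (s : Set (Space d))))).2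
      fun s _ => (convex_convexHull ℝ _).addHaar_frontier volume)
  rintro x ⟨hx, hxU⟩
  rw [h, Set.mem_iUnion₂] at hx
  obtain ⟨s, hs, hxs⟩ := hx
  refine Set.mem_biUnion hs ⟨subset_closure hxs, fun hxi => hxU ?_⟩
  rw [← hU.interior_closure, h]
  exact interior_mono (Set.subset_biUnion_of_mem (u := fun s : Finset (Space d) =>
    convexHull ℝ (s : Set (Space d))) hs) hxi

/-- Having linked balls around two points is a relation that holds between nearby points and is
symmetric and transitive, so on a connected set it holds between all pairs. -/
theorem linked_balls (hU : IsPolyhedralDomain U) {x y : Space d} (hx : x ∈ U) (hy : y ∈ U) :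
    ∃ r > 0, ∃ r' > 0, Metric.ball x r ⊆ U ∧ Metric.ball y r' ⊆ U ∧
      Linked (closure U) (Metric.ball x r) (Metric.ball y r') := by
  have hball : ∀ (z : Space d) (r : ℝ), Metric.ball z r ⊆ U →
      Linked (closure U) (Metric.ball z r) (Metric.ball z r) := fun z r h =>
    linked_self_of_convex (convex_ball z r) measurableSet_ball Metric.isBounded_ball
      (h.trans subset_closure)
  have hfin : ∀ (z : Space d) (r : ℝ), volume (Metric.ball z r) ≠ ∞ := fun z r =>
    measure_ball_lt_top.ne
  refine hU.isConnected.isPreconnected.induction₂ (fun x y => ∃ r > 0, ∃ r' > 0,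
    Metric.ball x r ⊆ U ∧ Metric.ball y r' ⊆ U ∧
      Linked (closure U) (Metric.ball x r) (Metric.ball y r')) ?_ ?_ ?_ hx hy
  · intro x hx
    obtain ⟨r, hr, hrU⟩ := Metric.isOpen_iff.1 hU.isOpen x hx
    refine mem_nhdsWithin_of_mem_nhds ?_
    filter_upwards [Metric.ball_mem_nhds x hr] with y hy
    obtain ⟨r', hr', hrr'⟩ := Metric.isOpen_iff.1 Metric.isOpen_ball y hy
    exact ⟨r, hr, r', hr', hrU, hrr'.trans hrU, (hball x r hrU).mono subset_rfl hrr'⟩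
  · rintro x y z - - - ⟨r1, hr1, r2, hr2, h1, h2, hL⟩ ⟨r3, hr3, r4, hr4, h3, h4, hL'⟩
    refine ⟨r1, hr1, r4, hr4, h1, h4, ?_⟩
    -- The two links give different radii at `y`; the smaller ball serves both.
    have hB : Metric.ball y (min r2 r3) ⊆ Metric.ball y r2 :=
      Metric.ball_subset_ball (min_le_left _ _)
    have hB' : Metric.ball y (min r2 r3) ⊆ Metric.ball y r3 :=
      Metric.ball_subset_ball (min_le_right _ _)
    exact (hL.mono subset_rfl hB).trans (hL'.mono hB' subset_rfl)
      (Metric.measure_ball_pos volume y (lt_min hr2 hr3)).ne' (hfin _ _) (hfin _ _) (hfin _ _)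
  · rintro x y - - ⟨r, hr, r', hr', h1, h2, h⟩
    exact ⟨r', hr', r, hr, h2, h1, h.symm⟩

/-- Each open simplex of the decomposition is linked to itself by convexity, and two of them are
joined through linked balls around an interior point of each. Finitely many open simplices cover `U`
up to a null set. -/
theorem linked (hU : IsPolyhedralDomain U) : Linked (closure U) U U := by
  obtain ⟨F, hF, hFs, h⟩ := hU.closure_eq
  set V : Finset (Space d) → Set (Space d) :=
    fun s => interior (convexHull ℝ (s : Set (Space d))) with hV
  have hsub : ∀ s ∈ F, convexHull ℝ (s : Set (Space d)) ⊆ closure U := fun s hs => by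
    rw [h]
    exact Set.subset_biUnion_of_mem (u := fun s : Finset (Space d) =>
      convexHull ℝ (s : Set (Space d))) hs
  have hVU : ∀ s ∈ F, V s ⊆ U := fun s hs =>
    (interior_mono (hsub s hs)).trans hU.interior_closure.subset
  have hVfin : ∀ s ∈ F, volume (V s) ≠ ∞ := fun s hs =>
    (measure_mono (hVU s hs)).trans_lt hU.volume_ne_top.lt_top |>.ne
  have hself : ∀ s ∈ F, Linked (closure U) (V s) (V s) := fun s hs =>
    linked_self_of_convex (convex_convexHull ℝ _).interior isOpen_interior.measurableSet
      ((isBounded_convexHull_finset s).subset interior_subset)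
      ((hVU s hs).trans subset_closure)
  have hpair : ∀ s ∈ F, ∀ t ∈ F, Linked (closure U) (V s) (V t) := by
    intro s hs t ht
    obtain ⟨x, hx⟩ := interior_convexHull_simplex_nonempty (hFs s hs).1 (hFs s hs).2
    obtain ⟨y, hy⟩ := interior_convexHull_simplex_nonempty (hFs t ht).1 (hFs t ht).2
    obtain ⟨r, hr, r', hr', -, -, hL⟩ := hU.linked_balls (hVU s hs hx) (hVU t ht hy)
    have hpos : ∀ (z : Space d) (ρ : ℝ) (W : Finset (Space d)), 0 < ρ → z ∈ V W →
        volume (V W ∩ Metric.ball z ρ) ≠ 0 := fun z ρ W hρ hz =>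
      ((isOpen_interior.inter Metric.isOpen_ball).measure_pos volume
        ⟨z, hz, Metric.mem_ball_self hρ⟩).ne'
    have hft : ∀ (A B : Set (Space d)), volume A ≠ ∞ → volume (A ∩ B) ≠ ∞ := fun A B hA =>
      (measure_mono Set.inter_subset_left).trans_lt hA.lt_top |>.ne
    have h1 : Linked (closure U) (V s) (V t ∩ Metric.ball y r') :=
      ((hself s hs).mono subset_rfl Set.inter_subset_left).trans
        (hL.mono (V' := V s ∩ Metric.ball x r) Set.inter_subset_right Set.inter_subset_right)
        (hpos x r s hr hx) (hft _ _ (hVfin s hs)) (hVfin s hs) (hft _ _ (hVfin t ht))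
    exact h1.trans ((hself t ht).mono Set.inter_subset_left subset_rfl) (hpos y r' t hr' hy)
      (hft _ _ (hVfin t ht)) (hVfin s hs) (hVfin t ht)
  have hall : Linked (closure U) (⋃ s ∈ hF.toFinset, V s) (⋃ s ∈ hF.toFinset, V s) := by
    refine linked_biUnion _ _ fun s hs => ?_
    refine (linked_biUnion _ _ fun t ht => ?_).symm
    exact hpair t (hF.mem_toFinset.1 ht) s (hF.mem_toFinset.1 hs)
  have h1 : (⋃ s ∈ hF.toFinset, V s) ≤ᵐ[volume] U :=
    Filter.Eventually.of_forall (Set.iUnion₂_subset fun s hs => hVU s (hF.mem_toFinset.1 hs))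
  have h2 : U ≤ᵐ[volume] ⋃ s ∈ hF.toFinset, V s := by
    have h3 : (⋃ s ∈ F, convexHull ℝ (s : Set (Space d))) ≤ᵐ[volume] ⋃ s ∈ F, V s :=
      Filter.EventuallyLE.countable_bUnion hF.countable fun s _ =>
        convex_interior_ae_eq (convex_convexHull ℝ _)
    rw [← h] at h3
    simp only [Set.Finite.mem_toFinset]
    exact Filter.EventuallyLE.trans (Filter.Eventually.of_forall subset_closure) h3
  exact hall.congr_ae h1 h2 h1 h2

end IsPolyhedralDomain

/-- Expanding the square, the cross term vanishes by the mean value condition, so `∫ (u x - u y)²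
dy` equals `|U| u(x)²` plus a nonnegative term. Integrating in `x` gives Poincaré's inequality. -/
theorem lintegral_sq_le_of_mean_zero {S U : Set (Space d)} (h : Linked S U U)
    (hU0 : volume U ≠ 0) (hU : volume U ≠ ∞) :
    ∃ C : ℝ≥0∞, C ≠ ∞ ∧ ∀ u g, IsSqUpperGradient S u g → IntegrableOn u U →
      IntegrableOn (fun x => u x ^ 2) U → ∫ x in U, u x = 0 →
      ∫⁻ x in U, ‖u x‖ₑ ^ 2 ≤ C * ∫⁻ x in S, g x := by
  obtain ⟨C, hC, h⟩ := h
  refine ⟨(volume U)⁻¹ * C, ?_, fun u g hug hu hu2 h0 => ?_⟩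
  · have : (volume U)⁻¹ ≠ ∞ := ENNReal.inv_ne_top.2 hU0
    finiteness
  have hsq : ∀ r : ℝ, ‖r‖ₑ ^ 2 = ENNReal.ofReal (r ^ 2) := fun r => by
    rw [Real.enorm_eq_ofReal_abs, ← ENNReal.ofReal_pow (abs_nonneg r), sq_abs]
  have key : ∀ x, volume U * ‖u x‖ₑ ^ 2 ≤ ∫⁻ y in U, ‖u x - u y‖ₑ ^ 2 := by
    intro x
    have hc : IntegrableOn (fun _ : Space d => u x ^ 2) U := integrableOn_const hU
    have hd : IntegrableOn (fun y => 2 * u x * u y) U := hu.const_mul _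
    have hi : IntegrableOn (fun y => (u x - u y) ^ 2) U := by
      refine ((hc.sub hd).add hu2).congr (Filter.Eventually.of_forall fun y => ?_)
      simp only [Pi.add_apply, Pi.sub_apply]
      ring
    have h1 : ∫ y in U, (u x - u y) ^ 2 = volume.real U * u x ^ 2 + ∫ y in U, u y ^ 2 := by
      have : (fun y => (u x - u y) ^ 2) = fun y => (u x ^ 2 - 2 * u x * u y) + u y ^ 2 := by
        funext y; ring
      have hcd : IntegrableOn (fun y => u x ^ 2 - 2 * u x * u y) U := hc.sub hd
      rw [this, integral_add hcd hu2, integral_sub hc hd, integral_const_mul, h0]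
      simp
    have h2 : ∫⁻ y in U, ‖u x - u y‖ₑ ^ 2 = ENNReal.ofReal (∫ y in U, (u x - u y) ^ 2) := by
      rw [ofReal_integral_eq_lintegral_ofReal hi (Filter.Eventually.of_forall fun y => sq_nonneg _)]
      simp_rw [hsq]
    rw [h2, h1, hsq, ← ofReal_measureReal hU, ← ENNReal.ofReal_mul measureReal_nonneg]
    exact ENNReal.ofReal_le_ofReal (le_add_of_nonneg_right (integral_nonneg fun y => sq_nonneg _))
  rw [mul_assoc, ← ENNReal.div_eq_inv_mul, ENNReal.le_div_iff_mul_le (Or.inl hU0) (Or.inl hU),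
    mul_comm, ← lintegral_const_mul' _ _ hU]
  exact (lintegral_mono key).trans (h u g hug)

/-- Write `u x = (u x - u y) + u y` and average over `y ∈ V`: control of the mass on a piece `V` of
positive measure spreads to all of `U`. -/
theorem lintegral_sq_le_of_subset {S U V : Set (Space d)} (h : Linked S U U) (hV : V ⊆ U)
    (hV0 : volume V ≠ 0) (hU : volume U ≠ ∞) {C₁ : ℝ≥0∞} (hC₁ : C₁ ≠ ∞) :
    ∃ C : ℝ≥0∞, C ≠ ∞ ∧ ∀ u g, IsSqUpperGradient S u g →
      ∫⁻ x in V, ‖u x‖ₑ ^ 2 ≤ C₁ * ∫⁻ x in S, g x →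
      ∫⁻ x in U, ‖u x‖ₑ ^ 2 ≤ C * ∫⁻ x in S, g x := by
  obtain ⟨C, hC, h⟩ := h.mono subset_rfl hV
  have hVt : volume V ≠ ∞ := ((measure_mono hV).trans_lt hU.lt_top).ne
  refine ⟨(volume V)⁻¹ * (2 * C + 2 * volume U * C₁), ?_, fun u g hug h1 => ?_⟩
  · have : (volume V)⁻¹ ≠ ∞ := ENNReal.inv_ne_top.2 hV0
    finiteness
  have hu := hug.measurable_fun
  rw [mul_assoc, ← ENNReal.div_eq_inv_mul, ENNReal.le_div_iff_mul_le (Or.inl hV0) (Or.inl hVt),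
    mul_comm]
  calc volume V * ∫⁻ x in U, ‖u x‖ₑ ^ 2 = ∫⁻ x in U, ∫⁻ _y in V, ‖u x - 0‖ₑ ^ 2 := by
        simp_rw [setLIntegral_const, lintegral_mul_const' _ _ hVt, mul_comm, sub_zero]
    _ ≤ ∫⁻ x in U, ∫⁻ y in V, (2 * ‖u x - u y‖ₑ ^ 2 + 2 * ‖u y - 0‖ₑ ^ 2) :=
        lintegral_mono fun x => lintegral_mono fun y => enorm_sub_sq_le _ _ _
    _ = 2 * (∫⁻ x in U, ∫⁻ y in V, ‖u x - u y‖ₑ ^ 2) +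
          2 * volume U * ∫⁻ y in V, ‖u y‖ₑ ^ 2 := by
        simp_rw [sub_zero]
        have : ∀ x, ∫⁻ y in V, (2 * ‖u x - u y‖ₑ ^ 2 + 2 * ‖u y‖ₑ ^ 2) =
            2 * (∫⁻ y in V, ‖u x - u y‖ₑ ^ 2) + 2 * ∫⁻ y in V, ‖u y‖ₑ ^ 2 := fun x => by
          rw [lintegral_add_left (by fun_prop), lintegral_const_mul' _ _ (by norm_num),
            lintegral_const_mul' _ _ (by norm_num)]
        simp_rw [this]
        rw [lintegral_add_right _ (by fun_prop), setLIntegral_const,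
            lintegral_const_mul' _ _ (by norm_num)]
        ring
    _ ≤ 2 * (C * ∫⁻ x in S, g x) + 2 * volume U * (C₁ * ∫⁻ x in S, g x) := by
        gcongr
        exact h u g hug
    _ = _ := by ring

/-- Moving in direction `q - p` shifts barycentric weight from `p` to `q`. After time `a`, the
initial weight of `p`, the face opposite `p` is reached. -/
theorem exists_mem_face_of_mem_simplex {s : Finset (Space d)} {p q : Space d} (hp : p ∈ s)
    (hq : q ∈ s) (hpq : p ≠ q) {x : Space d} (hx : x ∈ convexHull ℝ (s : Set (Space d))) :
    ∃ a ∈ Set.Icc (0 : ℝ) 1,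
      (∀ t ∈ Set.Icc 0 a, x + t • (q - p) ∈ convexHull ℝ (s : Set (Space d))) ∧
      x + a • (q - p) ∈ convexHull ℝ (s \ {p} : Set (Space d)) := by
  classical
  obtain ⟨w, hw0, hw1, hwx⟩ := Finset.mem_convexHull'.1 hx
  have hsplit : ∀ (f : Space d → ℝ), f p + ∑ y ∈ s.erase p, f y = ∑ y ∈ s, f y := fun f =>
    Finset.add_sum_erase s f hp
  have hsplit' : ∀ (f : Space d → Space d), f p + ∑ y ∈ s.erase p, f y = ∑ y ∈ s, f y := fun f =>
    Finset.add_sum_erase s f hp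
  have hqe : q ∈ s.erase p := Finset.mem_erase.2 ⟨hpq.symm, hq⟩
  have hwp : w p ≤ 1 := by
    rw [← hw1]
    exact Finset.single_le_sum hw0 hp
  have hA : x + w p • (q - p) ∈ convexHull ℝ (s \ {p} : Set (Space d)) := by
    rw [← Finset.coe_singleton, ← Finset.coe_sdiff, Finset.sdiff_singleton_eq_erase]
    refine Finset.mem_convexHull'.2 ⟨fun y => w y + if y = q then w p else 0, ?_, ?_, ?_⟩
    · intro y hy
      have h1 := hw0 y (Finset.mem_of_mem_erase hy)
      have h2 := hw0 p hp
      dsimp only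
      split_ifs <;> linarith
    · rw [Finset.sum_add_distrib, Finset.sum_ite_eq' _ q, if_pos hqe, ← hw1, ← hsplit, add_comm]
    · simp_rw [add_smul, ite_smul, zero_smul]
      rw [Finset.sum_add_distrib, Finset.sum_ite_eq' _ q, if_pos hqe, ← hwx, ← hsplit', smul_sub]
      abel
  refine ⟨w p, ⟨hw0 p hp, hwp⟩, fun t ht => ?_, hA⟩
  have hA' := convexHull_mono (𝕜 := ℝ) (Set.sdiff_subset : (s \ {p} : Set (Space d)) ⊆ s) hA
  rcases (hw0 p hp).eq_or_lt with h0 | h0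
  · have : t = 0 := le_antisymm (ht.2.trans h0.symm.le) ht.1
    simpa [this] using hx
  -- The path is the segment from `x` to its endpoint on the face, rescaled to unit time.
  · have h := (convex_convexHull ℝ (s : Set (Space d))).add_smul_sub_mem hx hA' (t := t / w p)
      ⟨div_nonneg ht.1 h0.le, (div_le_one h0).2 ht.2⟩
    rwa [add_sub_cancel_left, smul_smul, div_mul_cancel₀ _ h0.ne'] at h

/-- From every point of the simplex, the path in direction `q - p` ends where `u` vanishes.
Extending `g` by zero, the integral over starting points is bounded, for each time, by translation
invariance. -/
theorem lintegral_simplex_sq_le {S : Set (Space d)} {s : Finset (Space d)}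
    (hsS : convexHull ℝ (s : Set (Space d)) ⊆ S) {p q : Space d} (hp : p ∈ s) (hq : q ∈ s)
    (hpq : p ≠ q) {u : Space d → ℝ} {g : Space d → ℝ≥0∞} (hug : IsSqUpperGradient S u g)
    (h0 : ∀ x ∈ convexHull ℝ (s \ {p} : Set (Space d)), u x = 0) :
    ∫⁻ x in convexHull ℝ (s : Set (Space d)), ‖u x‖ₑ ^ 2 ≤ ‖q - p‖ₑ ^ 2 * ∫⁻ x in S, g x := by
  set A := convexHull ℝ (s : Set (Space d)) with hA
  have hAm : MeasurableSet A := (isCompact_convexHull_finset s).measurableSet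
  have hgm := hug.measurable_grad
  have hGm : Measurable (A.indicator g) := hgm.indicator hAm
  have key : ∀ x ∈ A, ‖u x‖ₑ ^ 2 ≤
      ‖q - p‖ₑ ^ 2 * ∫⁻ t in Set.Icc (0 : ℝ) 1, A.indicator g (x + t • (q - p)) := by
    intro x hx
    obtain ⟨a, ⟨ha0, ha1⟩, hseg, hend⟩ := exists_mem_face_of_mem_simplex hp hq hpq hx
    have h := hug.le x (q - p) a ha0 fun t ht => hsS (hseg t ht)
    rw [h0 _ hend, zero_sub, enorm_neg] at h
    refine h.trans ?_
    have h1 : ENNReal.ofReal a * ‖q - p‖ₑ ^ 2 ≤ ‖q - p‖ₑ ^ 2 := by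
      refine mul_le_of_le_one_left' ?_
      rw [← ENNReal.ofReal_one]
      exact ENNReal.ofReal_le_ofReal ha1
    refine mul_le_mul' h1 ?_
    calc ∫⁻ t in Set.Icc 0 a, g (x + t • (q - p))
        = ∫⁻ t in Set.Icc 0 a, A.indicator g (x + t • (q - p)) :=
          setLIntegral_congr_fun measurableSet_Icc fun t ht =>
            (Set.indicator_of_mem (hseg t ht) g).symm
      _ ≤ _ := lintegral_mono_set (Set.Icc_subset_Icc_right ha1)
  have hmeas : Measurable (Function.uncurry fun (x : Space d) (t : ℝ) =>
      A.indicator g (x + t • (q - p))) :=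
    hGm.comp (f := fun z : Space d × ℝ => z.1 + z.2 • (q - p)) (by fun_prop)
  calc ∫⁻ x in A, ‖u x‖ₑ ^ 2
      ≤ ∫⁻ x in A, ‖q - p‖ₑ ^ 2 * ∫⁻ t in Set.Icc (0 : ℝ) 1, A.indicator g (x + t • (q - p)) :=
        setLIntegral_mono' hAm key
    _ ≤ ∫⁻ x, ‖q - p‖ₑ ^ 2 * ∫⁻ t in Set.Icc (0 : ℝ) 1, A.indicator g (x + t • (q - p)) :=
        setLIntegral_le_lintegral _ _
    _ = ‖q - p‖ₑ ^ 2 * ∫⁻ t in Set.Icc (0 : ℝ) 1, ∫⁻ x, A.indicator g (x + t • (q - p)) := by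
        rw [lintegral_const_mul' _ _ (by finiteness), lintegral_lintegral_swap hmeas.aemeasurable]
    _ = ‖q - p‖ₑ ^ 2 * ∫⁻ x in A, g x := by
        simp_rw [lintegral_add_right_eq_self (A.indicator g)]
        simp [lintegral_indicator hAm]
    _ ≤ _ := by
        gcongr

end Polyhedral

/-! ### Upper gradients of piecewise affine functions -/

section PiecewiseAffine

open scoped ENNReal NNReal

variable {d : ℕ}

/-- Continuous induction on the interval: the set of `r` with `|φ r - φ s| ≤ L (r - s)` is closed,
and it can be extended to the right of each of its points below `t`. -/
theorem abs_sub_le_of_closed_cover {ι : Type*} [Finite ι] {φ : ℝ → ℝ} {s t L : ℝ}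
    (A : ι → Set ℝ) (hst : s ≤ t) (hφ : ContinuousOn φ (Set.Icc s t)) (hA : ∀ i, IsClosed (A i))
    (hcov : Set.Icc s t ⊆ ⋃ i, A i)
    (hL : ∀ i, ∀ x ∈ A i, ∀ y ∈ A i, x ≤ y → |φ y - φ x| ≤ L * (y - x)) :
    |φ t - φ s| ≤ L * (t - s) := by
  have hcl : IsClosed ({r | |φ r - φ s| ≤ L * (r - s)} ∩ Set.Icc s t) := by
    rw [Set.inter_comm]
    exact isClosed_Icc.isClosed_le (hφ.sub continuousOn_const).abs (by fun_prop)
  refine hcl.Icc_subset_of_forall_exists_gt (by simp) ?_ (Set.right_mem_Icc.2 hst)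
  rintro x ⟨hxB, hx⟩ y hy
  have hmin : x < min y t := lt_min hy hx.2
  have hev : ∀ᶠ r in nhdsWithin x (Set.Ioi x), r ∈ Set.Ioc x (min y t) := Ioc_mem_nhdsGT hmin
  -- Since the cover is finite, one piece contains points arbitrarily close to `x` on the right;
  -- being closed, it contains `x` as well.
  have hfreq : ∃ i, ∃ᶠ r in nhdsWithin x (Set.Ioi x), r ∈ A i := by
    by_contra! h
    obtain ⟨r, hr, hr'⟩ := ((Filter.eventually_all.2 h).and hev).exists
    obtain ⟨i, hi⟩ := Set.mem_iUnion.1 (hcov ⟨hx.1.trans hr'.1.le, hr'.2.trans (min_le_right _ _)⟩)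
    exact hr i hi
  obtain ⟨i, hi⟩ := hfreq
  have hxi : x ∈ A i := by
    rw [← (hA i).closure_eq, mem_closure_iff_frequently]
    exact hi.filter_mono nhdsWithin_le_nhds
  obtain ⟨r, hri, hr⟩ := (hi.and_eventually hev).exists
  refine ⟨r, ?_, hr.1, hr.2.trans (min_le_left _ _)⟩
  have h1 := hL i x hxi r hri hr.1.le
  have h2 : |φ x - φ s| ≤ L * (x - s) := hxB
  have h3 := abs_sub_le (φ r) (φ x) (φ s)
  change |φ r - φ s| ≤ L * (r - s)
  linarith

theorem lintegral_sq_le_mul {a : ℝ} {f : ℝ → ℝ≥0∞} (hf : Measurable f) :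
    (∫⁻ t in Set.Icc 0 a, f t) ^ 2 ≤ ENNReal.ofReal a * ∫⁻ t in Set.Icc 0 a, f t ^ 2 := by
  have h := ENNReal.lintegral_mul_le_Lp_mul_Lq (volume.restrict (Set.Icc 0 a))
    Real.HolderConjugate.two_two (f := fun _ => 1) (g := f) aemeasurable_const hf.aemeasurable
  simp only [Pi.mul_apply, one_mul, ENNReal.rpow_ofNat, one_pow, lintegral_const,
    Measure.restrict_apply MeasurableSet.univ, Set.univ_inter, Real.volume_Icc, sub_zero] at h
  calc _ ≤ (ENNReal.ofReal a ^ (1 / 2 : ℝ) * (∫⁻ t in Set.Icc 0 a, f t ^ 2) ^ (1 / 2 : ℝ)) ^ 2 := by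
        gcongr
    _ = _ := by
        rw [mul_pow, ← ENNReal.rpow_natCast, ← ENNReal.rpow_natCast, ← ENNReal.rpow_mul,
          ← ENNReal.rpow_mul]
        norm_num

open Classical in
/-- The squared norm of the derivative, set to `∞` where the function is not differentiable. -/
noncomputable def sqDeriv (u : Space d → ℝ) (x : Space d) : ℝ≥0∞ :=
  if DifferentiableAt ℝ u x then ‖fderiv ℝ u x‖ₑ ^ 2 else ∞

theorem measurable_sqDeriv (u : Space d → ℝ) : Measurable (sqDeriv u) := by
  have h := (measurable_fderiv ℝ u).enorm.pow_const 2
  exact Measurable.ite (measurableSet_of_differentiableAt ℝ u) h measurable_const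

/-- Fundamental theorem of calculus for a Lipschitz function on the segment, followed by
Cauchy-Schwarz. At points where `u` is not differentiable the bound is trivial because `sqDeriv` is
`∞`, so segments running inside mesh faces need no special care. -/
theorem enorm_sub_sq_le_lintegral_sqDeriv {u : Space d → ℝ} {x v : Space d} {a : ℝ} {K : ℝ≥0}
    (ha : 0 ≤ a) (hu : LipschitzOnWith K (fun t : ℝ => u (x + t • v)) (Set.Icc 0 a)) :
    ‖u (x + a • v) - u x‖ₑ ^ 2 ≤
      ENNReal.ofReal a * ‖v‖ₑ ^ 2 * ∫⁻ t in Set.Icc 0 a, sqDeriv u (x + t • v) := by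
  rcases eq_or_ne v 0 with rfl | hv
  · simp
  set φ : ℝ → ℝ := fun t => u (x + t • v) with hφ
  have hpt : ∀ t, ‖deriv φ t‖ₑ ^ 2 ≤ ‖v‖ₑ ^ 2 * sqDeriv u (x + t • v) := by
    intro t
    by_cases h : DifferentiableAt ℝ u (x + t • v)
    · have h1 : HasDerivAt (fun t : ℝ => x + t • v) v t := by
        simpa using ((hasDerivAt_id t).smul_const v).const_add x
      have h2 : HasDerivAt φ (fderiv ℝ u (x + t • v) v) t :=
        h.hasFDerivAt.comp_hasDerivAt (f := fun t : ℝ => x + t • v) t h1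
      rw [h2.deriv, sqDeriv, if_pos h, ← mul_pow, mul_comm]
      gcongr
      exact ContinuousLinearMap.le_opENorm _ _
    · rw [sqDeriv, if_neg h, ENNReal.mul_top (by simpa using hv)]
      exact le_top
  have hint : φ a - φ 0 = ∫ t in (0 : ℝ)..a, deriv φ t := by
    refine (AbsolutelyContinuousOnInterval.integral_deriv_eq_sub ?_).symm
    exact LipschitzOnWith.absolutelyContinuousOnInterval (by rwa [Set.uIcc_of_le ha])
  have h0 : φ a - φ 0 = u (x + a • v) - u x := by simp [hφ]
  have hle : ‖φ a - φ 0‖ₑ ≤ ∫⁻ t in Set.Icc 0 a, ‖deriv φ t‖ₑ := by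
    rw [hint, intervalIntegral.integral_of_le ha, ← integral_Icc_eq_integral_Ioc]
    exact enorm_integral_le_lintegral_enorm _
  rw [← h0]
  calc ‖φ a - φ 0‖ₑ ^ 2 ≤ (∫⁻ t in Set.Icc 0 a, ‖deriv φ t‖ₑ) ^ 2 := by gcongr
    _ ≤ ENNReal.ofReal a * ∫⁻ t in Set.Icc 0 a, ‖deriv φ t‖ₑ ^ 2 :=
        lintegral_sq_le_mul (measurable_deriv φ).enorm
    _ ≤ ENNReal.ofReal a * ∫⁻ t in Set.Icc 0 a, ‖v‖ₑ ^ 2 * sqDeriv u (x + t • v) := by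
        gcongr with t
        exact hpt t
    _ = _ := by
        rw [lintegral_const_mul' _ _ (by finiteness), mul_assoc]

theorem isSqUpperGradient_of_piecewise_affine {ι : Type*} [Finite ι] {S : Set (Space d)}
    {u : Space d → ℝ} (hum : Measurable u) (hu : ContinuousOn u S) (A : ι → Set (Space d))
    (hA : ∀ i, IsClosed (A i)) (hcov : S ⊆ ⋃ i, A i)
    (haff : ∀ i, ∃ k : Space d →ᵃ[ℝ] ℝ, Set.EqOn u k (A i)) :
    IsSqUpperGradient S u (sqDeriv u) where
  measurable_fun := hum
  measurable_grad := measurable_sqDeriv u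
  le x v a ha hS := by
    have := Fintype.ofFinite ι
    choose k hk using haff
    -- Any Lipschitz constant along the segment will do, since it does not enter the conclusion; the
    -- sum dominates the slope of every piece.
    set L : ℝ := ∑ i, |(k i).linear v| with hL
    have hL0 : 0 ≤ L := Finset.sum_nonneg fun i _ => abs_nonneg _
    have hcont : ContinuousOn (fun t : ℝ => u (x + t • v)) (Set.Icc 0 a) :=
      hu.comp (by fun_prop) hS
    refine enorm_sub_sq_le_lintegral_sqDeriv (K := ⟨L, hL0⟩) ha ?_
    have hmain : ∀ s ∈ Set.Icc 0 a, ∀ t ∈ Set.Icc 0 a, s ≤ t →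
        |u (x + t • v) - u (x + s • v)| ≤ L * (t - s) := by
      intro s hs t ht hst
      have hsub : Set.Icc s t ⊆ Set.Icc 0 a := Set.Icc_subset_Icc hs.1 ht.2
      refine abs_sub_le_of_closed_cover (φ := fun t => u (x + t • v))
        (fun i => (fun t : ℝ => x + t • v) ⁻¹' A i) hst (hcont.mono hsub)
        (fun i => (hA i).preimage (by fun_prop)) (fun r hr => ?_) ?_
      · obtain ⟨i, hi⟩ := Set.mem_iUnion.1 (hcov (hS r (hsub hr)))
        exact Set.mem_iUnion.2 ⟨i, hi⟩
      · intro i r hr r' hr' hrr'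
        have h1 : k i (x + r' • v) - k i (x + r • v) = (r' - r) * (k i).linear v := by
          have := (k i).linearMap_vsub (x + r' • v) (x + r • v)
          simp only [vsub_eq_sub, add_sub_add_left_eq_sub, ← sub_smul, map_smul, smul_eq_mul] at this
          exact this.symm
        rw [hk i hr', hk i hr, h1, abs_mul, abs_of_nonneg (sub_nonneg.2 hrr'), mul_comm]
        exact mul_le_mul_of_nonneg_right (Finset.single_le_sum
          (f := fun i => |(k i).linear v|) (fun i _ => abs_nonneg _) (Finset.mem_univ i))
          (sub_nonneg.2 hrr')
    refine LipschitzOnWith.of_dist_le_mul fun s hs t ht => ?_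
    rw [Real.dist_eq, Real.dist_eq]
    change _ ≤ L * _
    rcases le_total s t with h | h
    · rw [abs_sub_comm, abs_sub_comm s, abs_of_nonneg (sub_nonneg.2 h)]
      exact hmain s hs t ht h
    · rw [abs_of_nonneg (sub_nonneg.2 h)]
      exact hmain t ht s hs h

end PiecewiseAffine

open scoped ENNReal NNReal

/-! ### Low-dimensional faces are null for surface measure -/

section Hausdorff

variable {d : ℕ}

/-- Fewer than `d` points span an affine subspace of dimension below `d - 1`, whose Hausdorff
dimension is therefore too small to carry `(d-1)`-dimensional measure. -/
theorem hausdorffMeasure_convexHull_eq_zero {t : Finset (Space d)} (ht : t.card < d) :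
    surfaceMeasure d (convexHull ℝ (t : Set (Space d))) = 0 := by
  rcases t.eq_empty_or_nonempty with rfl | ⟨p, hp⟩
  · simp
  have hfin : Module.finrank ℝ (vectorSpan ℝ (t : Set (Space d))) < d - 1 := by
    have h := finrank_vectorSpan_image_finset_le ℝ (id : Space d → Space d) t
      (n := t.card - 1) (by have := Finset.card_pos.2 ⟨p, hp⟩; omega)
    have hc := Finset.card_pos.2 ⟨p, hp⟩
    rw [Finset.image_id] at h
    omega
  let ι : vectorSpan ℝ (t : Set (Space d)) → Space d := fun w => w + p
  have hι : LipschitzWith 1 ι := by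
    refine LipschitzWith.of_dist_le_mul fun x y => ?_
    simp [ι, Subtype.dist_eq]
  have hsub : convexHull ℝ (t : Set (Space d)) ⊆ Set.range ι := by
    intro x hx
    have hx' : x ∈ affineSpan ℝ (t : Set (Space d)) := convexHull_subset_affineSpan _ hx
    have h1 := AffineSubspace.vsub_mem_direction hx' (subset_affineSpan ℝ _ hp)
    rw [direction_affineSpan] at h1
    exact ⟨⟨x -ᵥ p, h1⟩, by simp [ι]⟩
  have hdim : dimH (convexHull ℝ (t : Set (Space d))) < ((d - 1 : ℕ) : ℝ≥0) := by
    refine ((dimH_mono hsub).trans hι.dimH_range_le).trans_lt ?_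
    rw [Real.dimH_univ_eq_finrank]
    exact_mod_cast hfin
  have h := hausdorffMeasure_of_dimH_lt hdim
  rw [surfaceMeasure]
  have h1 : (((d - 1 : ℕ) : ℝ≥0) : ℝ) = (d : ℝ) - 1 := by
    rw [NNReal.coe_natCast, Nat.cast_sub (by omega), Nat.cast_one]
  rwa [h1] at h

end Hausdorff

/-! ### Cells, integrals over subdomains and gradients of finite element functions -/

namespace Triangulation

variable {d M : ℕ} {G : ModelDomain d M} (T : Triangulation G)

theorem facets_finite : T.K.facets.Finite := T.finite.subset Geometry.SimplicialComplex.facets_subset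

theorem exists_facet {s : Finset (Space d)} (hs : s ∈ T.K.faces) : ∃ t ∈ T.K.facets, s ⊆ t := by
  obtain ⟨t, hst, ht⟩ := T.finite.exists_le_maximal hs
  exact ⟨t, ⟨ht.prop, fun r hr htr => le_antisymm htr (ht.le_of_ge hr htr)⟩, hst⟩

theorem affineIndependent {s : Finset (Space d)} (hs : s ∈ T.K.facets) :
    AffineIndependent ℝ ((↑) : s → Space d) := T.K.indep hs.1

/-- The open element belonging to a set of vertices. -/
def cell (s : Finset (Space d)) : Set (Space d) := interior (convexHull ℝ (s : Set (Space d)))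

theorem cell_subset (s : Finset (Space d)) : cell s ⊆ convexHull ℝ (s : Set (Space d)) :=
  interior_subset

theorem isOpen_cell (s : Finset (Space d)) : IsOpen (cell s) := isOpen_interior

theorem cell_nonempty {s : Finset (Space d)} (hs : s ∈ T.K.facets) : (cell s).Nonempty :=
  interior_convexHull_simplex_nonempty (T.affineIndependent hs) (T.pure s hs)

theorem volume_cell_ne_top (s : Finset (Space d)) : volume (cell s) ≠ ∞ :=
  ((isBounded_convexHull_finset s).subset interior_subset).measure_lt_top.ne

theorem cell_ae_eq (s : Finset (Space d)) :
    cell s =ᵐ[volume] convexHull ℝ (s : Set (Space d)) :=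
  Filter.EventuallyLE.antisymm (Filter.Eventually.of_forall interior_subset)
    (convex_interior_ae_eq (convex_convexHull ℝ _))

/-- Two elements meet in the hull of their common vertices. If that has interior points, there are
`d + 1` common vertices, so the two elements coincide. -/
theorem cell_disjoint {s t : Finset (Space d)} (hs : s ∈ T.K.facets) (ht : t ∈ T.K.facets)
    (hst : s ≠ t) : Disjoint (cell s) (cell t) := by
  classical
  rw [Set.disjoint_iff_inter_eq_empty, cell, cell, ← interior_inter,
    T.K.convexHull_inter_convexHull hs.1 ht.1, ← Set.not_nonempty_iff_eq_empty,
    interior_convexHull_nonempty_iff_affineSpan_eq_top, ← Finset.coe_inter]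
  intro h
  have hi : AffineIndependent ℝ ((↑) : (s ∩ t : Finset (Space d)) → Space d) :=
    AffineIndependent.mono (t := (s : Set (Space d))) (T.affineIndependent hs)
      (Finset.coe_subset.2 Finset.inter_subset_left)
  have hc := hi.affineSpan_eq_top_iff_card_eq_finrank_add_one.1 (by
    rw [Subtype.range_coe_subtype]; exact h)
  rw [Fintype.card_coe, finrank_euclideanSpace_fin, ← T.pure s hs] at hc
  have h1 := Finset.eq_of_subset_of_card_le Finset.inter_subset_left hc.ge
  exact hst (hs.2 ht.1 (Finset.inter_eq_left.1 h1))

/-- The elements contained in the closure of the `m`-th subdomain. -/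
def elems (m : Fin M) : Set (Finset (Space d)) :=
  {s ∈ T.K.facets | convexHull ℝ (s : Set (Space d)) ⊆ closure (G.sub m)}

theorem elems_finite (m : Fin M) : (T.elems m).Finite := T.facets_finite.subset fun _ hs => hs.1

theorem cell_subset_sub {m : Fin M} {s : Finset (Space d)} (hs : s ∈ T.elems m) :
    cell s ⊆ G.sub m :=
  (interior_mono hs.2).trans (G.polyhedral_sub m).interior_closure.subset

theorem sub_ae_eq (m : Fin M) :
    G.sub m =ᵐ[volume] ⋃ s ∈ (T.elems_finite m).toFinset, cell s := by
  have h : closure (G.sub m) =ᵐ[volume] ⋃ s ∈ T.elems m, cell s := by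
    rw [T.resolves_sub m]
    exact Filter.EventuallyEq.countable_bUnion (T.elems_finite m).countable fun s _ =>
      (cell_ae_eq s).symm
  simp only [Set.Finite.mem_toFinset]
  exact (G.polyhedral_sub m).closure_ae_eq.symm.trans h

theorem ae_mem_cell (m : Fin M) :
    ∀ᵐ x ∂volume.restrict (G.sub m), ∃ s ∈ T.elems m, x ∈ cell s := by
  rw [ae_restrict_iff' (G.polyhedral_sub m).isOpen.measurableSet]
  filter_upwards [(T.sub_ae_eq m).mem_iff] with x hx hxm
  have := hx.1 hxm
  simpa using this

theorem setIntegral_sub (m : Fin M) {f : Space d → ℝ}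
    (hf : ∀ s ∈ T.elems m, IntegrableOn f (cell s)) :
    ∫ x in G.sub m, f x = ∑ s ∈ (T.elems_finite m).toFinset, ∫ x in cell s, f x := by
  rw [setIntegral_congr_set (T.sub_ae_eq m), integral_biUnion_finset]
  · exact fun s _ => (isOpen_cell s).measurableSet
  · intro s hs t ht hst
    simp only [Set.Finite.coe_toFinset] at hs ht
    exact T.cell_disjoint hs.1 ht.1 hst
  · exact fun s hs => hf s ((T.elems_finite m).mem_toFinset.1 hs)

theorem integrableOn_sub (m : Fin M) {f : Space d → ℝ}
    (hf : ∀ s ∈ T.elems m, IntegrableOn f (cell s)) : IntegrableOn f (G.sub m) := by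
  rw [integrableOn_congr_set_ae (T.sub_ae_eq m), integrableOn_finset_iUnion]
  exact fun s hs => hf s ((T.elems_finite m).mem_toFinset.1 hs)

theorem sub_subset (G : ModelDomain d M) (m : Fin M) : closure (G.sub m) ⊆ closure G.Ω := by
  rw [G.closure_eq]
  exact Set.subset_iUnion (fun m => closure (G.sub m)) m

theorem sub_subset_Ω (G : ModelDomain d M) (m : Fin M) : G.sub m ⊆ G.Ω := by
  rw [← (G.polyhedral_sub m).interior_closure, ← G.polyhedral.interior_closure]
  exact interior_mono (sub_subset G m)

theorem measurable_fe {u : Space d → ℝ} (hu : u ∈ T.feSpace) : Measurable u := by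
  classical
  have h : u = (closure G.Ω).piecewise u fun _ => 0 := by
    funext x
    by_cases hx : x ∈ closure G.Ω
    · simp [hx]
    · simp [hx, hu.2.2.2 x hx]
  rw [h]
  exact hu.1.measurable_piecewise continuousOn_const isClosed_closure.measurableSet

theorem isSqUpperGradient_fe {u : Space d → ℝ} (hu : u ∈ T.feSpace) {S : Set (Space d)}
    (hS : S ⊆ closure G.Ω) : IsSqUpperGradient S u (sqDeriv u) := by
  have := T.finite.to_subtype
  refine isSqUpperGradient_of_piecewise_affine (T.measurable_fe hu) (hu.1.mono hS)
    (fun s : T.K.faces => convexHull ℝ ((s : Finset (Space d)) : Set (Space d)))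
    (fun s => (isCompact_convexHull_finset s.1).isClosed) ?_ fun s => hu.2.1 s s.2
  rw [← T.space_eq, Geometry.SimplicialComplex.space, Set.biUnion_eq_iUnion] at hS
  exact hS

theorem exists_gradient {u : Space d → ℝ} (hu : u ∈ T.feSpace) {s : Finset (Space d)}
    (hs : s ∈ T.K.facets) : ∃ w : Space d, (∀ x ∈ cell s, HasGradientAt u w x) ∧
      ∃ k : Space d →ᵃ[ℝ] ℝ, Set.EqOn u k (convexHull ℝ (s : Set (Space d))) ∧
        ∀ v, k.linear v = ⟪w, v⟫_ℝ := by
  obtain ⟨k, hk⟩ := hu.2.1 s hs.1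
  let l : Space d →L[ℝ] ℝ := LinearMap.toContinuousLinearMap k.linear
  refine ⟨(InnerProductSpace.toDual ℝ (Space d)).symm l, fun x hx => ?_, k, hk, fun v => by
    rw [InnerProductSpace.toDual_symm_apply]; rfl⟩
  have h1 : HasFDerivAt k l x := by
    have h2 : (k : Space d → ℝ) = fun y => l y + k 0 := by
      funext y
      exact congrFun (AffineMap.decomp k) y
    rw [h2]
    exact l.hasFDerivAt.add_const _
  have h3 : u =ᶠ[nhds x] k := by
    filter_upwards [(isOpen_cell s).mem_nhds hx] with y hy using hk (cell_subset s hy)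
  rw [hasGradientAt_iff_hasFDerivAt, LinearIsometryEquiv.apply_symm_apply]
  exact h1.congr_of_eventuallyEq h3

theorem hasGradientAt_fe {u : Space d → ℝ} (hu : u ∈ T.feSpace) {s : Finset (Space d)}
    (hs : s ∈ T.K.facets) {x : Space d} (hx : x ∈ cell s) : HasGradientAt u (∇ u x) x := by
  obtain ⟨w, hw, -⟩ := T.exists_gradient hu hs
  exact (hw x hx).differentiableAt.hasGradientAt

theorem integrableOn_cell_inner {u v : Space d → ℝ} (hu : u ∈ T.feSpace) (hv : v ∈ T.feSpace)
    {s : Finset (Space d)} (hs : s ∈ T.K.facets) :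
    IntegrableOn (fun x => ⟪∇ u x, ∇ v x⟫_ℝ) (cell s) := by
  obtain ⟨w, hw, -⟩ := T.exists_gradient hu hs
  obtain ⟨z, hz, -⟩ := T.exists_gradient hv hs
  have h : IntegrableOn (fun _ => ⟪w, z⟫_ℝ) (cell s) := integrableOn_const (volume_cell_ne_top s)
  refine h.congr_fun (fun x hx => ?_) (isOpen_cell s).measurableSet
  simp only [(hw x hx).gradient, (hz x hx).gradient]

theorem integrableOn_inner {u v : Space d → ℝ} (hu : u ∈ T.feSpace) (hv : v ∈ T.feSpace)
    (m : Fin M) : IntegrableOn (fun x => ⟪∇ u x, ∇ v x⟫_ℝ) (G.sub m) :=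
  T.integrableOn_sub m fun _ hs => T.integrableOn_cell_inner hu hv hs.1

theorem isCompact_closure_Ω (G : ModelDomain d M) : IsCompact (closure G.Ω) :=
  Metric.isCompact_of_isClosed_isBounded isClosed_closure G.polyhedral.isBounded_closure

theorem integrableOn_fe {u : Space d → ℝ} (hu : u ∈ T.feSpace) {S : Set (Space d)}
    (hS : S ⊆ closure G.Ω) : IntegrableOn u S :=
  (hu.1.integrableOn_compact (isCompact_closure_Ω G)).mono_set hS

theorem integrableOn_mul {u v : Space d → ℝ} (hu : u ∈ T.feSpace) (hv : v ∈ T.feSpace)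
    {S : Set (Space d)} (hS : S ⊆ closure G.Ω) : IntegrableOn (fun x => u x * v x) S :=
  ((hu.1.mul hv.1).integrableOn_compact (isCompact_closure_Ω G)).mono_set hS

theorem integrableOn_sq {u : Space d → ℝ} (hu : u ∈ T.feSpace)
    {S : Set (Space d)} (hS : S ⊆ closure G.Ω) : IntegrableOn (fun x => u x ^ 2) S := by
  simp_rw [sq]
  exact T.integrableOn_mul hu hu hS

theorem integrableOn_gradient_sq {u : Space d → ℝ} (hu : u ∈ T.feSpace) (m : Fin M) :
    IntegrableOn (fun x => ‖∇ u x‖ ^ 2) (G.sub m) := by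
  simp_rw [← real_inner_self_eq_norm_sq]
  exact T.integrableOn_inner hu hu m

theorem lintegral_sq_eq {u : Space d → ℝ} (hu : u ∈ T.feSpace) {S : Set (Space d)}
    (hS : S ⊆ closure G.Ω) :
    ∫⁻ x in S, ‖u x‖ₑ ^ 2 = ENNReal.ofReal (∫ x in S, u x ^ 2) := by
  rw [ofReal_integral_eq_lintegral_ofReal (T.integrableOn_sq hu hS)
    (Filter.Eventually.of_forall fun x => sq_nonneg _)]
  refine lintegral_congr fun x => ?_
  rw [Real.enorm_eq_ofReal_abs, ← ENNReal.ofReal_pow (abs_nonneg _), sq_abs]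

/-- Almost every point lies in an open cell, where `u` is differentiable; the infinite values of
`sqDeriv` sit on a null set. -/
theorem lintegral_sqDeriv_eq {u : Space d → ℝ} (hu : u ∈ T.feSpace) (m : Fin M) :
    ∫⁻ x in closure (G.sub m), sqDeriv u x =
      ENNReal.ofReal (∫ x in G.sub m, ‖∇ u x‖ ^ 2) := by
  rw [Measure.restrict_congr_set (G.polyhedral_sub m).closure_ae_eq,
    ofReal_integral_eq_lintegral_ofReal (T.integrableOn_gradient_sq hu m)
    (Filter.Eventually.of_forall fun x => sq_nonneg _)]
  refine lintegral_congr_ae ?_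
  filter_upwards [T.ae_mem_cell m] with x ⟨s, hs, hx⟩
  rw [sqDeriv, if_pos (T.hasGradientAt_fe hu hs.1 hx).differentiableAt,
    ENNReal.ofReal_pow (norm_nonneg _), ofReal_norm, ← toDual_gradient,
    LinearIsometryEquiv.enorm_map]

end Triangulation

open scoped ENNReal NNReal

/-! ### Mesh-independent constants, and nodal values against mass -/

namespace Triangulation

variable {d M : ℕ} {G : ModelDomain d M}

/-- The simplex `s` has exactly one vertex `p` outside `f`. Moving in direction `q - p` with `q ∈ f`
bounds the mass on `s`, and linkedness carries the bound to `U`. -/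
theorem friedrichs_of_face {U : Set (Space d)} (hU : IsPolyhedralDomain U)
    {s f : Finset (Space d)} (hs : AffineIndependent ℝ ((↑) : s → Space d)) (hsc : s.card = d + 1)
    (hsU : convexHull ℝ (s : Set (Space d)) ⊆ closure U) (hfs : f ⊆ s) (hf : f.Nonempty)
    (hfc : f.card = d) :
    ∃ C : ℝ≥0∞, C ≠ ∞ ∧ ∀ u g, IsSqUpperGradient (closure U) u g →
      (∀ x ∈ convexHull ℝ (f : Set (Space d)), u x = 0) →
      ∫⁻ x in U, ‖u x‖ₑ ^ 2 ≤ C * ∫⁻ x in closure U, g x := by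
  classical
  obtain ⟨p, hp⟩ : ∃ p, s \ f = {p} := by
    rw [← Finset.card_eq_one, Finset.card_sdiff_of_subset hfs]
    omega
  obtain ⟨q, hq⟩ := hf
  have hps : p ∈ s \ f := hp ▸ Finset.mem_singleton_self p
  have hfp : (s \ {p} : Set (Space d)) = f := by
    rw [← Finset.coe_singleton, ← hp, ← Finset.coe_sdiff, Finset.sdiff_sdiff_eq_self hfs]
  have hpq : p ≠ q := fun h => (Finset.mem_sdiff.1 hps).2 (h ▸ hq)
  have hV : cell s ⊆ U := (interior_mono hsU).trans hU.interior_closure.subset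
  have hV0 : volume (cell s) ≠ 0 :=
    ((isOpen_cell s).measure_pos volume (interior_convexHull_simplex_nonempty hs hsc)).ne'
  obtain ⟨C, hC, h⟩ := lintegral_sq_le_of_subset hU.linked hV hV0 hU.volume_ne_top
    (C₁ := ‖q - p‖ₑ ^ 2) (by finiteness)
  refine ⟨C, hC, fun u g hug h0 => h u g hug ?_⟩
  rw [Measure.restrict_congr_set (cell_ae_eq s)]
  exact lintegral_simplex_sq_le hsU (Finset.mem_sdiff.1 hps).1 (hfs hq) hpq hug
    (by rwa [hfp])

theorem exists_poincare_const (G : ModelDomain d M) (m : Fin M) :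
    ∃ C : ℝ, 0 ≤ C ∧ ∀ T : Triangulation G, ∀ u ∈ T.feSpace, ∫ x in G.sub m, u x = 0 →
      ∫ x in G.sub m, u x ^ 2 ≤ C * ∫ x in G.sub m, ‖∇ u x‖ ^ 2 := by
  have hU := G.polyhedral_sub m
  obtain ⟨C, hC, h⟩ := lintegral_sq_le_of_mean_zero hU.linked hU.volume_ne_zero hU.volume_ne_top
  refine ⟨C.toReal, ENNReal.toReal_nonneg, fun T u hu h0 => ?_⟩
  have hsub : G.sub m ⊆ closure G.Ω := subset_closure.trans (sub_subset G m)
  have h1 := h u _ (T.isSqUpperGradient_fe hu (sub_subset G m)) (T.integrableOn_fe hu hsub)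
    (T.integrableOn_sq hu hsub) h0
  rw [T.lintegral_sqDeriv_eq hu, T.lintegral_sq_eq hu hsub, ← ENNReal.ofReal_toReal hC,
    ← ENNReal.ofReal_mul ENNReal.toReal_nonneg] at h1
  refine (ENNReal.ofReal_le_ofReal_iff ?_).1 h1
  exact mul_nonneg ENNReal.toReal_nonneg (integral_nonneg fun x => sq_nonneg _)

/-- `T₀` only supplies a fixed element in the subdomain with a fixed face in `Γ_D`. The functions of
every other triangulation also vanish on that face, so the constant is the same for all. -/
theorem exists_friedrichs_const (hd : 0 < d) (T₀ : Triangulation G) (m : Fin M)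
    (hm : surfaceMeasure d (frontier (G.sub m) ∩ G.ΓD) ≠ 0) :
    ∃ C : ℝ, 0 ≤ C ∧ ∀ T : Triangulation G, ∀ u ∈ T.feSpace,
      ∫ x in G.sub m, u x ^ 2 ≤ C * ∫ x in G.sub m, ‖∇ u x‖ ^ 2 := by
  classical
  have hU := G.polyhedral_sub m
  set FD := {f ∈ T₀.K.faces | f.card = d ∧ convexHull ℝ (f : Set (Space d)) ⊆ G.ΓD} with hFD
  have hFDfin : FD.Finite := T₀.finite.subset fun f hf => hf.1
  obtain ⟨s, hs, f, hf, hfs⟩ : ∃ s ∈ T₀.elems m, ∃ f ∈ FD, f ⊆ s := by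
    -- If no element of the subdomain had a Dirichlet face, every intersection of an element with a
    -- Dirichlet face would have fewer than `d` vertices. Finitely many such null sets would cover
    -- `∂Ω_m ∩ Γ_D`.
    by_contra! hcon
    refine hm (measure_mono_null (t := ⋃ s ∈ T₀.elems m, ⋃ f ∈ FD,
      convexHull ℝ ((s ∩ f : Finset (Space d)) : Set (Space d))) ?_ ?_)
    · rintro x ⟨hx, hxD⟩
      have hx' := frontier_subset_closure hx
      rw [T₀.resolves_sub m] at hx'
      rw [T₀.resolves_ΓD] at hxD
      obtain ⟨s, hs, hxs⟩ := Set.mem_iUnion₂.1 hx'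
      obtain ⟨f, hf, hxf⟩ := Set.mem_iUnion₂.1 hxD
      refine Set.mem_biUnion hs (Set.mem_biUnion hf ?_)
      rw [Finset.coe_inter]
      exact T₀.K.inter_subset_convexHull hs.1.1 hf.1 ⟨hxs, hxf⟩
    · rw [measure_biUnion_null_iff (T₀.elems_finite m).countable]
      intro s hs
      rw [measure_biUnion_null_iff hFDfin.countable]
      intro f hf
      refine hausdorffMeasure_convexHull_eq_zero ?_
      refine lt_of_lt_of_eq ?_ hf.2.1
      refine Finset.card_lt_card (Finset.inter_subset_right.ssubset_of_ne fun h => ?_)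
      exact hcon s hs f hf (Finset.inter_eq_right.1 h)
  have hfne : f.Nonempty := Finset.card_pos.1 (by rw [hf.2.1]; exact hd)
  obtain ⟨C, hC, h⟩ := friedrichs_of_face hU (T₀.affineIndependent hs.1) (T₀.pure s hs.1) hs.2
    hfs hfne hf.2.1
  refine ⟨C.toReal, ENNReal.toReal_nonneg, fun T u hu => ?_⟩
  have hsub : G.sub m ⊆ closure G.Ω := subset_closure.trans (sub_subset G m)
  have h1 := h u _ (T.isSqUpperGradient_fe hu (sub_subset G m))
    fun x hx => hu.2.2.1 x (hf.2.2 hx)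
  rw [T.lintegral_sqDeriv_eq hu, T.lintegral_sq_eq hu hsub, ← ENNReal.ofReal_toReal hC,
    ← ENNReal.ofReal_mul ENNReal.toReal_nonneg] at h1
  refine (ENNReal.ofReal_le_ofReal_iff ?_).1 h1
  exact mul_nonneg ENNReal.toReal_nonneg (integral_nonneg fun x => sq_nonneg _)

theorem exists_friedrichs_const_Ω (hd : 0 < d) (T₀ : Triangulation G) :
    ∃ C : ℝ, 0 ≤ C ∧ ∀ T : Triangulation G, ∀ u ∈ T.feSpace,
      ∫ x in G.Ω, u x ^ 2 ≤ C * ∑ m, ∫ x in G.sub m, ‖∇ u x‖ ^ 2 := by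
  obtain ⟨f, hf, hfc, hfD⟩ : ∃ f ∈ T₀.K.faces, f.card = d ∧
      convexHull ℝ (f : Set (Space d)) ⊆ G.ΓD := by
    by_contra! hcon
    have h := G.ΓD_pos
    have h0 : G.ΓD = ∅ := by
      rw [T₀.resolves_ΓD]
      simp only [Set.iUnion_eq_empty]
      rintro f ⟨hf, hfc, hfD⟩
      exact absurd hfD (hcon f hf hfc)
    simp [h0] at h
  obtain ⟨s, hs, hfs⟩ := T₀.exists_facet hf
  have hsU : convexHull ℝ (s : Set (Space d)) ⊆ closure G.Ω := by
    rw [← T₀.space_eq]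
    exact T₀.K.convexHull_subset_space hs.1
  have hfne : f.Nonempty := Finset.card_pos.1 (by rw [hfc]; exact hd)
  obtain ⟨C, hC, h⟩ := friedrichs_of_face G.polyhedral (T₀.affineIndependent hs) (T₀.pure s hs)
    hsU hfs hfne hfc
  refine ⟨C.toReal, ENNReal.toReal_nonneg, fun T u hu => ?_⟩
  have hnn : ∀ m ∈ Finset.univ, 0 ≤ ∫ x in G.sub m, ‖∇ u x‖ ^ 2 := fun m _ =>
    integral_nonneg fun x => sq_nonneg _
  have h1 := h u _ (T.isSqUpperGradient_fe hu subset_rfl) fun x hx => hu.2.2.1 x (hfD hx)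
  have h2 : ∫⁻ x in closure G.Ω, sqDeriv u x ≤
      ENNReal.ofReal (∑ m, ∫ x in G.sub m, ‖∇ u x‖ ^ 2) := by
    rw [G.closure_eq, ENNReal.ofReal_sum_of_nonneg hnn]
    refine (lintegral_iUnion_le _ _).trans ?_
    rw [tsum_fintype]
    exact Finset.sum_le_sum fun m _ => (T.lintegral_sqDeriv_eq hu m).le
  have h3 := h1.trans (mul_le_mul_right h2 C)
  rw [T.lintegral_sq_eq hu subset_closure, ← ENNReal.ofReal_toReal hC,
    ← ENNReal.ofReal_mul ENNReal.toReal_nonneg] at h3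
  refine (ENNReal.ofReal_le_ofReal_iff ?_).1 h3
  exact mul_nonneg ENNReal.toReal_nonneg (Finset.sum_nonneg hnn)

/-- The squared nodal values of an affine function are controlled by its mass on a simplex. -/
theorem sum_sq_mul_volume_le {s : Finset (Space d)} (hs : s.Nonempty) (k : Space d →ᵃ[ℝ] ℝ) :
    (∑ p ∈ s, k p ^ 2) * volume.real (convexHull ℝ (s : Set (Space d))) ≤
      s.card * 4 ^ (d + 1) * ∫ x in convexHull ℝ (s : Set (Space d)), k x ^ 2 := by
  set A := convexHull ℝ (s : Set (Space d)) with hA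
  have hAc : IsCompact A := isCompact_convexHull_finset s
  have hkc : Continuous k := k.continuous_of_finiteDimensional
  -- `|k|` attains its maximum over the simplex at a vertex `p`.
  obtain ⟨p, hp, hmax⟩ := s.exists_max_image (fun p => |k p|) hs
  have hbound : ∀ y ∈ A, |k y| ≤ |k p| := by
    intro y hy
    obtain ⟨w, hw⟩ := exists_bary hy
    rw [map_bary hw k]
    calc |∑ y ∈ s, w y * k y| ≤ ∑ y ∈ s, |w y * k y| := Finset.abs_sum_le_sum_abs _ _
      _ ≤ ∑ y ∈ s, w y * |k p| := Finset.sum_le_sum fun y hy => by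
          rw [abs_mul, abs_of_nonneg (hw.1 y hy)]
          exact mul_le_mul_of_nonneg_left (hmax y hy) (hw.1 y hy)
      _ = |k p| := by rw [← Finset.sum_mul, hw.2.1, one_mul]
  have hpA : p ∈ A := subset_convexHull ℝ _ hp
  -- On the copy of the simplex shrunk by `1/4` towards `p`, `|k| ≥ (3/4 - 1/4) |k p|`. The constant
  -- `4^(d+1)` combines `4^d` from the volume of `Z` and `4` from squaring `1/2`.
  set Z := AffineMap.homothety p (1 / 4 : ℝ) '' A with hZ
  have hZA : Z ⊆ A := by
    rintro _ ⟨y, hy, rfl⟩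
    have h14 : (1 / 4 : ℝ) ∈ Set.Icc (0 : ℝ) 1 := by constructor <;> norm_num
    exact (convex_convexHull ℝ _).lineMap_mem hpA hy h14
  have hZm : MeasurableSet Z :=
    (hAc.image (AffineMap.continuous_of_finiteDimensional _)).measurableSet
  have hvol : volume.real Z = (1 / 4 : ℝ) ^ d * volume.real A := by
    rw [measureReal_def, Measure.addHaar_image_homothety, ENNReal.toReal_mul,
      finrank_euclideanSpace_fin, ENNReal.toReal_ofReal (abs_nonneg _), abs_of_nonneg (by positivity)]
    rfl
  have hlow : ∀ z ∈ Z, k p ^ 2 / 4 ≤ k z ^ 2 := by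
    rintro _ ⟨y, hy, rfl⟩
    have h1 : k (AffineMap.homothety p (1 / 4 : ℝ) y) = 3 / 4 * k p + 1 / 4 * k y := by
      rw [AffineMap.homothety_eq_lineMap, AffineMap.apply_lineMap, AffineMap.lineMap_apply]
      simp only [vsub_eq_sub, smul_eq_mul, vadd_eq_add]
      ring
    rw [h1]
    have h2 := hbound y hy
    have h3 := sq_le_sq.2 h2
    have h4 : -(k p * k y) ≤ k p ^ 2 := by
      have h5 : |k p * k y| ≤ |k p| * |k p| := by
        rw [abs_mul]; exact mul_le_mul_of_nonneg_left h2 (abs_nonneg _)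
      have := neg_abs_le (k p * k y)
      rw [abs_mul_abs_self] at h5
      nlinarith
    nlinarith [sq_nonneg (k y)]
  have hi : IntegrableOn (fun x => k x ^ 2) A := (by fun_prop : Continuous fun x => k x ^ 2).continuousOn.integrableOn_compact hAc
  have hZt : volume Z ≠ ∞ := ((measure_mono hZA).trans_lt hAc.measure_lt_top).ne
  have h1 : k p ^ 2 / 4 * volume.real Z ≤ ∫ x in A, k x ^ 2 :=
    calc k p ^ 2 / 4 * volume.real Z = ∫ _x in Z, k p ^ 2 / 4 := by
          rw [setIntegral_const, smul_eq_mul, mul_comm]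
      _ ≤ ∫ x in Z, k x ^ 2 :=
          setIntegral_mono_on (integrableOn_const hZt) (hi.mono_set hZA) hZm hlow
      _ ≤ ∫ x in A, k x ^ 2 :=
          setIntegral_mono_set hi (Filter.Eventually.of_forall fun x => sq_nonneg _)
            (Filter.Eventually.of_forall hZA)
  have h2 : ∑ q ∈ s, k q ^ 2 ≤ s.card * k p ^ 2 := by
    rw [← nsmul_eq_mul]
    exact Finset.sum_le_card_nsmul _ _ _ fun q hq => sq_le_sq.2 (hmax q hq)
  have hv : 0 ≤ volume.real A := measureReal_nonneg
  have h3 : k p ^ 2 * volume.real A ≤ 4 ^ (d + 1) * ∫ x in A, k x ^ 2 := by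
    have h4 : k p ^ 2 * volume.real A = 4 ^ (d + 1) * (k p ^ 2 / 4 * volume.real Z) := by
      rw [hvol, one_div, inv_pow]
      field_simp
      ring
    rw [h4]
    exact mul_le_mul_of_nonneg_left h1 (by positivity)
  calc _ ≤ s.card * k p ^ 2 * volume.real A := mul_le_mul_of_nonneg_right h2 hv
    _ = s.card * (k p ^ 2 * volume.real A) := by ring
    _ ≤ s.card * (4 ^ (d + 1) * ∫ x in A, k x ^ 2) :=
        mul_le_mul_of_nonneg_left h3 (Nat.cast_nonneg _)
    _ = _ := by ring

variable (T : Triangulation G)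

theorem sum_sq_mul_volume_cell_le {u : Space d → ℝ} (hu : u ∈ T.feSpace) {s : Finset (Space d)}
    (hs : s ∈ T.K.facets) :
    (∑ p ∈ s, u p ^ 2) * volume.real (cell s) ≤
      (d + 1) * 4 ^ (d + 1) * ∫ x in cell s, u x ^ 2 := by
  obtain ⟨k, hk⟩ := hu.2.1 s hs.1
  have hne : s.Nonempty := T.K.nonempty_of_mem_faces hs.1
  have h := sum_sq_mul_volume_le hne k
  rw [T.pure s hs] at h
  rw [measureReal_congr (cell_ae_eq s), setIntegral_congr_set (cell_ae_eq s),
    Finset.sum_congr rfl fun p hp => by rw [hk (subset_convexHull ℝ _ hp)],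
    setIntegral_congr_fun (g := fun x => k x ^ 2) (isCompact_convexHull_finset s).measurableSet
      fun x hx => by simp only [hk hx]]
  exact_mod_cast h

/-- A function bounded on the elements by the squared nodal values of `u` is bounded in the mean
by the mass of `u`. -/
theorem setIntegral_le_mass {u : Space d → ℝ} (hu : u ∈ T.feSpace) (m : Fin M)
    {f : Space d → ℝ} (hf : IntegrableOn f (G.sub m)) {b : ℝ} (hb : 0 ≤ b)
    (h : ∀ s ∈ T.elems m, ∀ x ∈ cell s, f x ≤ b * ∑ p ∈ s, u p ^ 2) :
    ∫ x in G.sub m, f x ≤ b * ((d + 1) * 4 ^ (d + 1)) * ∫ x in G.sub m, u x ^ 2 := by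
  have hsub : G.sub m ⊆ closure G.Ω := subset_closure.trans (sub_subset G m)
  rw [T.setIntegral_sub m fun s hs => hf.mono_set (T.cell_subset_sub hs),
    T.setIntegral_sub m fun s hs => T.integrableOn_sq hu ((T.cell_subset_sub hs).trans hsub),
    Finset.mul_sum]
  refine Finset.sum_le_sum fun s hs => ?_
  have hs' := (T.elems_finite m).mem_toFinset.1 hs
  calc ∫ x in cell s, f x ≤ ∫ _x in cell s, b * ∑ p ∈ s, u p ^ 2 :=
        setIntegral_mono_on (hf.mono_set (T.cell_subset_sub hs'))
          (integrableOn_const (volume_cell_ne_top s)) (isOpen_cell s).measurableSet (h s hs')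
    _ = b * ((∑ p ∈ s, u p ^ 2) * volume.real (cell s)) := by
        rw [setIntegral_const, smul_eq_mul]; ring
    _ ≤ b * ((d + 1) * 4 ^ (d + 1) * ∫ x in cell s, u x ^ 2) :=
        mul_le_mul_of_nonneg_left (T.sum_sq_mul_volume_cell_le hu hs'.1) hb
    _ = _ := by ring

end Triangulation

open scoped ENNReal NNReal

/-! ### Mesh size, hat functions and inverse estimates -/

namespace Triangulation

variable {d M : ℕ} {G : ModelDomain d M} (T : Triangulation G)

theorem facets_nonempty : T.K.facets.Nonempty := by
  obtain ⟨x, hx⟩ := G.polyhedral.isConnected.nonempty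
  have hx' := subset_closure hx
  rw [← T.space_eq] at hx'
  obtain ⟨s, hs, -⟩ := Geometry.SimplicialComplex.mem_space_iff.1 hx'
  obtain ⟨t, ht, -⟩ := T.exists_facet hs
  exact ⟨t, ht⟩

theorem diam_le_meshSize {s : Finset (Space d)} (hs : s ∈ T.K.facets) :
    Metric.diam (convexHull ℝ (s : Set (Space d))) ≤ T.meshSize := by
  have := T.facets_finite.to_subtype
  exact le_ciSup (f := fun s : T.K.facets =>
    Metric.diam (convexHull ℝ ((s : Finset (Space d)) : Set (Space d))))
    (Set.finite_range _).bddAbove ⟨s, hs⟩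

theorem meshSize_pos (hd : 0 < d) : 0 < T.meshSize := by
  obtain ⟨s, hs⟩ := T.facets_nonempty
  refine lt_of_lt_of_le ?_ (T.diam_le_meshSize hs)
  obtain ⟨p, hp, q, hq, hpq⟩ := Finset.one_lt_card.1 (by rw [T.pure s hs]; omega : 1 < s.card)
  exact (dist_pos.2 hpq).trans_le (Metric.dist_le_diam_of_mem (isBounded_convexHull_finset s)
    (subset_convexHull ℝ _ hp) (subset_convexHull ℝ _ hq))

theorem meshSize_le : T.meshSize ≤ Metric.diam (closure G.Ω) := by
  have := T.facets_nonempty.to_subtype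
  refine ciSup_le fun s => Metric.diam_mono ?_ G.polyhedral.isBounded_closure
  rw [← T.space_eq]
  exact T.K.convexHull_subset_space s.2.1

theorem hat_mem_Icc {s : Finset (Space d)} (hs : s ∈ T.K.faces) (p : Space d) {x : Space d}
    (hx : x ∈ convexHull ℝ (s : Set (Space d))) : T.hat p x ∈ Set.Icc (0 : ℝ) 1 := by
  classical
  obtain ⟨w, hw⟩ := exists_bary hx
  rw [T.hat_eq hs hw]
  split_ifs with hp
  · refine ⟨hw.1 p hp, ?_⟩
    rw [← hw.2.1]
    exact Finset.single_le_sum hw.1 hp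
  · simp

theorem hat_eq_zero {s : Finset (Space d)} (hs : s ∈ T.K.faces) {p : Space d} (hp : p ∉ s)
    {x : Space d} (hx : x ∈ convexHull ℝ (s : Set (Space d))) : T.hat p x = 0 := by
  obtain ⟨w, hw⟩ := exists_bary hx
  rw [T.hat_eq hs hw, if_neg hp]

theorem gradient_hat_eq_zero {s : Finset (Space d)} (hs : s ∈ T.K.facets) {p : Space d}
    (hp : p ∉ s) {x : Space d} (hx : x ∈ cell s) : ∇ (T.hat p) x = 0 := by
  have h : T.hat p =ᶠ[nhds x] fun _ => 0 := by
    filter_upwards [(isOpen_cell s).mem_nhds hx] with y hy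
    exact T.hat_eq_zero hs.1 hp (cell_subset s hy)
  rw [h.gradient_eq, gradient_fun_const]

/-- A hat function takes values in `[0,1]`, so on a ball of radius `r` inside the element its affine
piece varies by at most `1` over a step of length `r/2`. -/
theorem norm_gradient_hat_le {σ : ℝ} (hσ : 0 < σ) (hd : 0 < d) (hT : T.QuasiUniform σ)
    (p : T.FreeVertex) {s : Finset (Space d)} (hs : s ∈ T.K.facets) {x : Space d}
    (hx : x ∈ cell s) : ‖∇ (T.hat p.1) x‖ ≤ 2 / (σ * T.meshSize) := by
  obtain ⟨z, hz⟩ := hT s hs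
  have hr : 0 < σ * T.meshSize := mul_pos hσ (T.meshSize_pos hd)
  set r := σ * T.meshSize
  obtain ⟨w, hw, k, hk, hkw⟩ := T.exists_gradient (T.hat_mem p) hs
  rw [(hw x hx).gradient]
  rcases eq_or_ne w 0 with rfl | hw0
  · rw [norm_zero]; positivity
  have hwn : 0 < ‖w‖ := norm_pos_iff.2 hw0
  -- The step has length `r/2`, not `r`, to stay inside the open ball.
  set v : Space d := (r / (2 * ‖w‖)) • w with hv
  have hvn : ‖v‖ = r / 2 := by
    rw [hv, norm_smul, Real.norm_of_nonneg (by positivity)]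
    field_simp
  have hzv : z + v ∈ Metric.ball z r := by
    rw [mem_ball_iff_norm, add_sub_cancel_left, hvn]
    linarith
  have h1 := T.hat_mem_Icc hs.1 p.1 (hz hzv)
  have h2 := T.hat_mem_Icc hs.1 p.1 (hz (Metric.mem_ball_self hr))
  rw [hk (hz hzv)] at h1
  rw [hk (hz (Metric.mem_ball_self hr))] at h2
  have h3 : k (z + v) - k z = ⟪w, v⟫_ℝ := by
    have := k.linearMap_vsub (z + v) z
    rw [vsub_eq_sub, add_sub_cancel_left, vsub_eq_sub, hkw] at this
    exact this.symm
  have h4 : ⟪w, v⟫_ℝ = r / 2 * ‖w‖ := by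
    rw [hv, inner_smul_right, real_inner_self_eq_norm_sq]
    field_simp
  rw [le_div_iff₀ hr]
  have := h1.2
  have := h2.1
  nlinarith

theorem sum_free_le (u : Space d → ℝ) (s : Finset (Space d)) {f : T.FreeVertex → ℝ} {b : ℝ}
    (hb : 0 ≤ b) (hf : ∀ p : T.FreeVertex, f p ≤ b) (hf' : ∀ p : T.FreeVertex, p.1 ∉ s → f p = 0) :
    ∑ p : T.FreeVertex, u p.1 ^ 2 * f p ≤ b * ∑ q ∈ s, u q ^ 2 := by
  classical
  calc ∑ p : T.FreeVertex, u p.1 ^ 2 * f p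
      = ∑ p ∈ Finset.univ.filter fun p : T.FreeVertex => p.1 ∈ s, u p.1 ^ 2 * f p := by
        refine (Finset.sum_filter_of_ne fun p _ h => ?_).symm
        by_contra hp
        exact h (by rw [hf' p hp, mul_zero])
    _ ≤ ∑ p ∈ Finset.univ.filter fun p : T.FreeVertex => p.1 ∈ s, b * u p.1 ^ 2 :=
        Finset.sum_le_sum fun p _ => by
          rw [mul_comm b]
          exact mul_le_mul_of_nonneg_left (hf p) (sq_nonneg _)
    _ = ∑ q ∈ (Finset.univ.filter fun p : T.FreeVertex => p.1 ∈ s).map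
          (Function.Embedding.subtype _), b * u q ^ 2 := by
        rw [Finset.sum_map]; rfl
    _ ≤ ∑ q ∈ s, b * u q ^ 2 := by
        refine Finset.sum_le_sum_of_subset_of_nonneg (fun q hq => ?_) fun _ _ _ => by positivity
        obtain ⟨p, hp, rfl⟩ := Finset.mem_map.1 hq
        exact (Finset.mem_filter.1 hp).2
    _ = _ := by rw [Finset.mul_sum]

theorem sub_subset_closure_Ω (G : ModelDomain d M) (m : Fin M) : G.sub m ⊆ closure G.Ω :=
  subset_closure.trans (sub_subset G m)

theorem sum_sq_mul_mass_hat_le {u : Space d → ℝ} (hu : u ∈ T.feSpace) (m : Fin M) :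
    ∑ p : T.FreeVertex, u p.1 ^ 2 * ∫ x in G.sub m, T.hat p.1 x ^ 2 ≤
      (d + 1) * 4 ^ (d + 1) * ∫ x in G.sub m, u x ^ 2 := by
  have hi : ∀ p ∈ Finset.univ, IntegrableOn
      (fun x => u (p : T.FreeVertex).1 ^ 2 * T.hat p.1 x ^ 2) (G.sub m) := fun p _ =>
    (T.integrableOn_sq (T.hat_mem p) (sub_subset_closure_Ω G m)).const_mul _
  have hsum : ∑ p : T.FreeVertex, u p.1 ^ 2 * ∫ x in G.sub m, T.hat p.1 x ^ 2 =
      ∫ x in G.sub m, ∑ p : T.FreeVertex, u p.1 ^ 2 * T.hat p.1 x ^ 2 := by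
    rw [integral_finsetSum _ hi]
    simp_rw [integral_const_mul]
  rw [hsum]
  refine (T.setIntegral_le_mass hu m (integrable_finsetSum _ hi) zero_le_one
    fun s hs x hx => T.sum_free_le u s zero_le_one (fun p => ?_) fun p hp => ?_).trans_eq
    (by rw [one_mul])
  · have h := T.hat_mem_Icc hs.1.1 p.1 (cell_subset s hx)
    exact pow_le_one₀ h.1 h.2
  · rw [T.hat_eq_zero hs.1.1 hp (cell_subset s hx)]
    norm_num

/-- The inverse estimate: replacing each gradient by its bound `2/(σh)` leaves the nodal values on
the element, which the mass controls. Quasi-uniformity is needed only for this gradient bound. -/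
theorem sum_sq_mul_energy_hat_le {σ : ℝ} (hσ : 0 < σ) (hd : 0 < d) (hT : T.QuasiUniform σ)
    {u : Space d → ℝ} (hu : u ∈ T.feSpace) (m : Fin M) :
    ∑ p : T.FreeVertex, u p.1 ^ 2 * ∫ x in G.sub m, ‖∇ (T.hat p.1) x‖ ^ 2 ≤
      (2 / (σ * T.meshSize)) ^ 2 * ((d + 1) * 4 ^ (d + 1)) * ∫ x in G.sub m, u x ^ 2 := by
  have hi : ∀ p ∈ Finset.univ, IntegrableOn
      (fun x => u (p : T.FreeVertex).1 ^ 2 * ‖∇ (T.hat p.1) x‖ ^ 2) (G.sub m) := fun p _ =>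
    (T.integrableOn_gradient_sq (T.hat_mem p) m).const_mul _
  have hsum : ∑ p : T.FreeVertex, u p.1 ^ 2 * ∫ x in G.sub m, ‖∇ (T.hat p.1) x‖ ^ 2 =
      ∫ x in G.sub m, ∑ p : T.FreeVertex, u p.1 ^ 2 * ‖∇ (T.hat p.1) x‖ ^ 2 := by
    rw [integral_finsetSum _ hi]
    simp_rw [integral_const_mul]
  rw [hsum]
  refine T.setIntegral_le_mass hu m (integrable_finsetSum _ hi) (sq_nonneg _)
    fun s hs x hx => T.sum_free_le u s (sq_nonneg _) (fun p => ?_) fun p hp => ?_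
  · exact pow_le_pow_left₀ (norm_nonneg _) (T.norm_gradient_hat_le hσ hd hT p hs.1 hx) 2
  · rw [T.gradient_hat_eq_zero hs.1 hp hx]
    simp

theorem card_free_le {s : Finset (Space d)} (hs : s ∈ T.K.facets) [DecidableEq (Space d)] :
    (Finset.univ.filter fun p : T.FreeVertex => p.1 ∈ s).card ≤ d + 1 := by
  rw [← T.pure s hs, ← Finset.card_map (Function.Embedding.subtype _)]
  refine Finset.card_le_card fun q hq => ?_
  obtain ⟨p, hp, rfl⟩ := Finset.mem_map.1 hq
  exact (Finset.mem_filter.1 hp).2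

/-- Cauchy-Schwarz over the at most `d + 1` free vertices of `s`. This is the source of the bound `d
+ 1` for the largest eigenvalue. -/
theorem norm_sum_sq_le {E : Type*} [SeminormedAddCommGroup E] {s : Finset (Space d)}
    (hs : s ∈ T.K.facets) (f : T.FreeVertex → E) (hf : ∀ p : T.FreeVertex, p.1 ∉ s → f p = 0) :
    ‖∑ p, f p‖ ^ 2 ≤ (d + 1) * ∑ p, ‖f p‖ ^ 2 := by
  classical
  set F := Finset.univ.filter fun p : T.FreeVertex => p.1 ∈ s with hF
  have h1 : ∑ p, f p = ∑ p ∈ F, f p :=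
    (Finset.sum_filter_of_ne fun p _ h => by_contra fun hp => h (hf p hp)).symm
  rw [h1]
  calc ‖∑ p ∈ F, f p‖ ^ 2 ≤ (∑ p ∈ F, ‖f p‖) ^ 2 :=
        pow_le_pow_left₀ (norm_nonneg _) (norm_sum_le _ _) 2
    _ ≤ F.card * ∑ p ∈ F, ‖f p‖ ^ 2 := sq_sum_le_card_mul_sum_sq
    _ ≤ (d + 1) * ∑ p, ‖f p‖ ^ 2 := by
        refine mul_le_mul (by exact_mod_cast T.card_free_le hs)
          (Finset.sum_le_sum_of_subset_of_nonneg (Finset.subset_univ _) fun _ _ _ => sq_nonneg _)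
          (Finset.sum_nonneg fun _ _ => sq_nonneg _) (by positivity)

theorem eq_sum_hat {u : Space d → ℝ} (hu : u ∈ T.feSpace) :
    u = fun x => ∑ p : T.FreeVertex, u p.1 * T.hat p.1 x := by
  have h := T.nodalEquiv.symm_apply_apply ⟨u, hu⟩
  have h2 := congrArg Subtype.val h
  funext x
  refine (congrFun h2 x).symm.trans ?_
  simp [nodalEquiv, Finset.sum_apply]

theorem gradient_eq_sum_hat {u : Space d → ℝ} (hu : u ∈ T.feSpace) {s : Finset (Space d)}
    (hs : s ∈ T.K.facets) {x : Space d} (hx : x ∈ cell s) :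
    ∇ u x = ∑ p : T.FreeVertex, u p.1 • ∇ (T.hat p.1) x := by
  refine HasGradientAt.gradient ?_
  rw [hasGradientAt_iff_hasFDerivAt, map_sum]
  have h : HasFDerivAt (fun x => ∑ p : T.FreeVertex, u p.1 * T.hat p.1 x)
      (∑ p : T.FreeVertex, u p.1 • (InnerProductSpace.toDual ℝ (Space d)) (∇ (T.hat p.1) x)) x :=
    HasFDerivAt.fun_sum fun p _ =>
      (hasGradientAt_iff_hasFDerivAt.1 (T.hasGradientAt_fe (T.hat_mem p) hs hx)).const_mul (u p.1)
  rw [← T.eq_sum_hat hu] at h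
  simpa using h

theorem mass_le_sum_sq_mul {u : Space d → ℝ} (hu : u ∈ T.feSpace) (m : Fin M) :
    ∫ x in G.sub m, u x ^ 2 ≤
      (d + 1) * ∑ p : T.FreeVertex, u p.1 ^ 2 * ∫ x in G.sub m, T.hat p.1 x ^ 2 := by
  have hi : ∀ p ∈ Finset.univ, IntegrableOn
      (fun x => u (p : T.FreeVertex).1 ^ 2 * T.hat p.1 x ^ 2) (G.sub m) := fun p _ =>
    (T.integrableOn_sq (T.hat_mem p) (sub_subset_closure_Ω G m)).const_mul _
  simp_rw [← integral_const_mul]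
  rw [← integral_finsetSum _ hi, ← integral_const_mul]
  refine integral_mono_ae (T.integrableOn_sq hu (sub_subset_closure_Ω G m))
    ((integrable_finsetSum _ hi).const_mul _) ?_
  filter_upwards [T.ae_mem_cell m] with x ⟨s, hs, hx⟩
  have h := T.norm_sum_sq_le hs.1 (fun p => u p.1 * T.hat p.1 x) fun p hp => by
    rw [T.hat_eq_zero hs.1.1 hp (cell_subset s hx), mul_zero]
  rw [← congrFun (T.eq_sum_hat hu) x] at h
  simpa [mul_pow] using h

theorem energy_le_sum_sq_mul {u : Space d → ℝ} (hu : u ∈ T.feSpace) (m : Fin M) :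
    ∫ x in G.sub m, ‖∇ u x‖ ^ 2 ≤
      (d + 1) * ∑ p : T.FreeVertex, u p.1 ^ 2 * ∫ x in G.sub m, ‖∇ (T.hat p.1) x‖ ^ 2 := by
  have hi : ∀ p ∈ Finset.univ, IntegrableOn
      (fun x => u (p : T.FreeVertex).1 ^ 2 * ‖∇ (T.hat p.1) x‖ ^ 2) (G.sub m) := fun p _ =>
    (T.integrableOn_gradient_sq (T.hat_mem p) m).const_mul _
  simp_rw [← integral_const_mul]
  rw [← integral_finsetSum _ hi, ← integral_const_mul]
  refine integral_mono_ae (T.integrableOn_gradient_sq hu m)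
    ((integrable_finsetSum _ hi).const_mul _) ?_
  filter_upwards [T.ae_mem_cell m] with x ⟨s, hs, hx⟩
  have h := T.norm_sum_sq_le hs.1 (fun p => u p.1 • ∇ (T.hat p.1) x) fun p hp => by
    rw [T.gradient_hat_eq_zero hs.1 hp hx, smul_zero]
  rw [← T.gradient_eq_sum_hat hu hs.1 hx] at h
  simpa [norm_smul, mul_pow] using h

end Triangulation

/-! ### The stiffness matrix and its diagonal -/

namespace Triangulation

variable {d M : ℕ} {G : ModelDomain d M} (T : Triangulation G)

theorem form_comm (ω ρ : Fin M → ℝ) (u v : Space d → ℝ) :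
    G.form ω ρ u v = G.form ω ρ v u := by
  simp only [ModelDomain.form, real_inner_comm, mul_comm]

theorem form_add_left (ω ρ : Fin M → ℝ) {u v w : Space d → ℝ} (hu : u ∈ T.feSpace)
    (hv : v ∈ T.feSpace) (hw : w ∈ T.feSpace) :
    G.form ω ρ (u + v) w = G.form ω ρ u w + G.form ω ρ v w := by
  have h1 : ∀ m, ∫ x in G.sub m, ω m * ⟪∇ (u + v) x, ∇ w x⟫_ℝ =
      (∫ x in G.sub m, ω m * ⟪∇ u x, ∇ w x⟫_ℝ) + ∫ x in G.sub m, ω m * ⟪∇ v x, ∇ w x⟫_ℝ := by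
    intro m
    rw [← integral_add ((T.integrableOn_inner hu hw m).const_mul _)
      ((T.integrableOn_inner hv hw m).const_mul _)]
    refine integral_congr_ae ?_
    filter_upwards [T.ae_mem_cell m] with x ⟨s, hs, hx⟩
    have h : HasGradientAt (u + v) (∇ u x + ∇ v x) x := by
      rw [hasGradientAt_iff_hasFDerivAt, map_add]
      exact (T.hasGradientAt_fe hu hs.1 hx).hasFDerivAt.add (T.hasGradientAt_fe hv hs.1 hx).hasFDerivAt
    rw [h.gradient, inner_add_left, mul_add]
  have h2 : ∀ m, ∫ x in G.sub m, ρ m * ((u + v) x * w x) =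
      (∫ x in G.sub m, ρ m * (u x * w x)) + ∫ x in G.sub m, ρ m * (v x * w x) := by
    intro m
    have hm := sub_subset_closure_Ω G m
    rw [← integral_add ((T.integrableOn_mul hu hw hm).const_mul _)
      ((T.integrableOn_mul hv hw hm).const_mul _)]
    simp only [Pi.add_apply, add_mul, mul_add]
  simp only [ModelDomain.form, h1, h2, Finset.sum_add_distrib]
  ring

theorem form_smul_left (ω ρ : Fin M → ℝ) (c : ℝ) {u w : Space d → ℝ} (hu : u ∈ T.feSpace) :
    G.form ω ρ (c • u) w = c * G.form ω ρ u w := by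
  have h1 : ∀ m, ∫ x in G.sub m, ω m * ⟪∇ (c • u) x, ∇ w x⟫_ℝ =
      c * ∫ x in G.sub m, ω m * ⟪∇ u x, ∇ w x⟫_ℝ := by
    intro m
    rw [← integral_const_mul]
    refine integral_congr_ae ?_
    filter_upwards [T.ae_mem_cell m] with x ⟨s, hs, hx⟩
    have h : HasGradientAt (c • u) (c • ∇ u x) x := by
      rw [hasGradientAt_iff_hasFDerivAt]
      simpa using (T.hasGradientAt_fe hu hs.1 hx).hasFDerivAt.const_smul c
    rw [h.gradient, real_inner_smul_left]
    ring
  have h2 : ∀ m, ∫ x in G.sub m, ρ m * ((c • u) x * w x) =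
      c * ∫ x in G.sub m, ρ m * (u x * w x) := by
    intro m
    rw [← integral_const_mul]
    refine integral_congr_ae (Filter.Eventually.of_forall fun x => ?_)
    simp only [Pi.smul_apply, smul_eq_mul]
    ring
  simp only [ModelDomain.form, h1, h2, ← Finset.mul_sum]
  ring

/-- The bilinear form on the finite element space. -/
noncomputable def formBilin (ω ρ : Fin M → ℝ) : T.feSpace →ₗ[ℝ] T.feSpace →ₗ[ℝ] ℝ :=
  LinearMap.mk₂ ℝ (fun u v => G.form ω ρ u.1 v.1)
    (fun u v w => T.form_add_left ω ρ u.2 v.2 w.2)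
    (fun c u _ => T.form_smul_left ω ρ c u.2)
    (fun u v w => by
      rw [form_comm, form_comm ω ρ u.1, form_comm ω ρ u.1]
      exact T.form_add_left ω ρ v.2 w.2 u.2)
    (fun c u v => by
      rw [form_comm, form_comm ω ρ u.1]
      exact T.form_smul_left ω ρ c v.2)

theorem form_self (ω ρ : Fin M → ℝ) (u : Space d → ℝ) :
    G.form ω ρ u u =
      ∑ m, (ω m * (∫ x in G.sub m, ‖∇ u x‖ ^ 2) + ρ m * ∫ x in G.sub m, u x ^ 2) := by
  simp only [ModelDomain.form, real_inner_self_eq_norm_sq, ← sq, integral_const_mul,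
    Finset.sum_add_distrib]

theorem stiffness_isHermitian (ω ρ : Fin M → ℝ) : (T.stiffness ω ρ).IsHermitian := by
  refine Matrix.IsHermitian.ext fun i j => ?_
  simp only [stiffness, Matrix.of_apply, star_trivial]
  exact form_comm ω ρ _ _

theorem stiffness_diag (ω ρ : Fin M → ℝ) (p : T.FreeVertex) :
    T.stiffness ω ρ p p = G.form ω ρ (T.hat p.1) (T.hat p.1) := by
  simp only [stiffness, Matrix.of_apply, nodalBasis_apply]

theorem nodalEquiv_symm_apply (x : T.FreeVertex → ℝ) (p : T.FreeVertex) :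
    (T.nodalEquiv.symm x).1 p.1 = x p :=
  congrFun (T.nodalEquiv.apply_symm_apply x) p

theorem dotProduct_stiffness (ω ρ : Fin M → ℝ) (x : T.FreeVertex → ℝ) :
    dotProduct x ((T.stiffness ω ρ).mulVec x) =
      G.form ω ρ (T.nodalEquiv.symm x).1 (T.nodalEquiv.symm x).1 := by
  have h : T.nodalEquiv.symm x = ∑ p, x p • T.nodalBasis p := by
    have := T.nodalBasis.sum_equivFun (T.nodalEquiv.symm x)
    simpa [nodalBasis] using this.symm
  have h2 : G.form ω ρ (T.nodalEquiv.symm x).1 (T.nodalEquiv.symm x).1 =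
      T.formBilin ω ρ (T.nodalEquiv.symm x) (T.nodalEquiv.symm x) := rfl
  rw [h2, h]
  simp only [map_sum, LinearMap.sum_apply, map_smul, LinearMap.smul_apply, smul_eq_mul, dotProduct,
    Matrix.mulVec, Finset.mul_sum]
  refine Finset.sum_congr rfl fun i _ => Finset.sum_congr rfl fun j _ => ?_
  change x i * (G.form ω ρ (T.nodalBasis j).1 (T.nodalBasis i).1 * x j) =
    x i * (x j * G.form ω ρ (T.nodalBasis j).1 (T.nodalBasis i).1)
  ring

theorem energy_nonneg (G : ModelDomain d M) (u : Space d → ℝ) (m : Fin M) :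
    0 ≤ ∫ x in G.sub m, ‖∇ u x‖ ^ 2 := integral_nonneg fun _ => sq_nonneg _

theorem mass_nonneg (u : Space d → ℝ) (S : Set (Space d)) : 0 ≤ ∫ x in S, u x ^ 2 :=
  integral_nonneg fun _ => sq_nonneg _

theorem sum_diag_eq (ω ρ : Fin M → ℝ) (x : T.FreeVertex → ℝ) :
    ∑ p, T.stiffness ω ρ p p * x p ^ 2 =
      ∑ m, (ω m * (∑ p : T.FreeVertex, x p ^ 2 * ∫ y in G.sub m, ‖∇ (T.hat p.1) y‖ ^ 2) +
        ρ m * ∑ p : T.FreeVertex, x p ^ 2 * ∫ y in G.sub m, T.hat p.1 y ^ 2) := by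
  simp only [stiffness_diag, form_self, Finset.sum_mul, Finset.mul_sum]
  simp only [← Finset.sum_add_distrib]
  rw [Finset.sum_comm]
  exact Finset.sum_congr rfl fun m _ => Finset.sum_congr rfl fun p _ => by ring

/-- The finite-overlap bounds hold on each subdomain separately for energy and mass, so they can be
added with arbitrary nonnegative weights. -/
theorem dotProduct_stiffness_le {ω ρ : Fin M → ℝ} (hω : ∀ m, 0 < ω m) (hρ : ∀ m, 0 ≤ ρ m)
    (x : T.FreeVertex → ℝ) :
    dotProduct x ((T.stiffness ω ρ).mulVec x) ≤ (d + 1) * ∑ p, T.stiffness ω ρ p p * x p ^ 2 := by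
  rw [dotProduct_stiffness, form_self, sum_diag_eq, Finset.mul_sum]
  refine Finset.sum_le_sum fun m _ => ?_
  have h1 := T.energy_le_sum_sq_mul (T.nodalEquiv.symm x).2 m
  have h2 := T.mass_le_sum_sq_mul (T.nodalEquiv.symm x).2 m
  simp only [nodalEquiv_symm_apply] at h1 h2
  calc _ ≤ ω m * _ + ρ m * _ := add_le_add (mul_le_mul_of_nonneg_left h1 (hω m).le)
        (mul_le_mul_of_nonneg_left h2 (hρ m))
    _ = _ := by ring

/-- The inverse estimate turns the `ω`-part of the diagonal into `h⁻²` times weighted mass, which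
the hypothesis with constant `B` bounds by the energy. The `ρ`-part is already bounded by the
`ρ`-part of the form. -/
theorem sum_diag_le {σ : ℝ} (hσ : 0 < σ) (hd : 0 < d) (hT : T.QuasiUniform σ) {ω ρ : Fin M → ℝ}
    (hω : ∀ m, 0 < ω m) (hρ : ∀ m, 0 ≤ ρ m) {B : ℝ} (hB : 0 ≤ B) (x : T.FreeVertex → ℝ)
    (hx : ∑ m, ω m * ∫ y in G.sub m, (T.nodalEquiv.symm x).1 y ^ 2 ≤
      B * ∑ m, ω m * ∫ y in G.sub m, ‖∇ (T.nodalEquiv.symm x).1 y‖ ^ 2) :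
    ∑ p, T.stiffness ω ρ p p * x p ^ 2 ≤
      ((d + 1) * 4 ^ (d + 1) * (4 / σ ^ 2 * B + Metric.diam (closure G.Ω) ^ 2)) *
        (T.meshSize ^ 2)⁻¹ * dotProduct x ((T.stiffness ω ρ).mulVec x) := by
  set u := T.nodalEquiv.symm x with hu
  set h := T.meshSize
  set D := Metric.diam (closure G.Ω)
  set K : ℝ := (d + 1) * 4 ^ (d + 1) with hK
  have hh : 0 < h := T.meshSize_pos hd
  have hhD : h ≤ D := T.meshSize_le
  have hK0 : 0 ≤ K := by positivity
  set E := ∑ m, ω m * ∫ y in G.sub m, ‖∇ u.1 y‖ ^ 2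
  set R := ∑ m, ρ m * ∫ y in G.sub m, u.1 y ^ 2
  have hE : 0 ≤ E := Finset.sum_nonneg fun m _ => mul_nonneg (hω m).le (energy_nonneg G _ m)
  have hR : 0 ≤ R := Finset.sum_nonneg fun m _ => mul_nonneg (hρ m) (mass_nonneg _ _)
  rw [dotProduct_stiffness, form_self, sum_diag_eq]
  have h1 : ∀ m, ω m * (∑ p : T.FreeVertex, x p ^ 2 * ∫ y in G.sub m, ‖∇ (T.hat p.1) y‖ ^ 2) +
      ρ m * (∑ p : T.FreeVertex, x p ^ 2 * ∫ y in G.sub m, T.hat p.1 y ^ 2) ≤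
      (2 / (σ * h)) ^ 2 * K * (ω m * ∫ y in G.sub m, u.1 y ^ 2) +
        K * (ρ m * ∫ y in G.sub m, u.1 y ^ 2) := by
    intro m
    have h1 := T.sum_sq_mul_energy_hat_le hσ hd hT u.2 m
    have h2 := T.sum_sq_mul_mass_hat_le u.2 m
    simp only [hu, nodalEquiv_symm_apply] at h1 h2
    calc _ ≤ ω m * _ + ρ m * _ := add_le_add (mul_le_mul_of_nonneg_left h1 (hω m).le)
          (mul_le_mul_of_nonneg_left h2 (hρ m))
      _ = _ := by ring
  have hsum : ∑ m, (ω m * (∫ y in G.sub m, ‖∇ u.1 y‖ ^ 2) + ρ m * ∫ y in G.sub m, u.1 y ^ 2) =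
      E + R := Finset.sum_add_distrib
  rw [hsum]
  have hfac : (2 / (σ * h)) ^ 2 * K = K * (4 / σ ^ 2) * (h ^ 2)⁻¹ := by
    field_simp
    ring
  -- The `ρ`-part carries no factor `h⁻²`; since `h ≤ diam Ω`, one is inserted at the price of `D²`.
  have hD1 : 1 ≤ D ^ 2 * (h ^ 2)⁻¹ := by
    rw [← div_eq_mul_inv, one_le_div (by positivity)]
    exact pow_le_pow_left₀ hh.le hhD 2
  calc _ ≤ ∑ m, ((2 / (σ * h)) ^ 2 * K * (ω m * ∫ y in G.sub m, u.1 y ^ 2) +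
        K * (ρ m * ∫ y in G.sub m, u.1 y ^ 2)) := Finset.sum_le_sum fun m _ => h1 m
    _ = (2 / (σ * h)) ^ 2 * K * (∑ m, ω m * ∫ y in G.sub m, u.1 y ^ 2) + K * R := by
        rw [Finset.sum_add_distrib, ← Finset.mul_sum, ← Finset.mul_sum]
    _ ≤ (2 / (σ * h)) ^ 2 * K * (B * E) + K * R := by gcongr
    _ = K * (4 / σ ^ 2 * B) * (h ^ 2)⁻¹ * E + K * R * 1 := by rw [hfac]; ring
    _ ≤ K * (4 / σ ^ 2 * B) * (h ^ 2)⁻¹ * (E + R) + K * (E + R) * (D ^ 2 * (h ^ 2)⁻¹) := by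
        gcongr <;> linarith
    _ = _ := by ring

/-- As `ρ` may vanish, positivity has to come from the energy. If that is zero, Friedrichs'
inequality makes the mass of the hat function zero, contradicting its nodal value `1` at `p`. -/
theorem stiffness_diag_pos (hd : 0 < d) {ω ρ : Fin M → ℝ} (hω : ∀ m, 0 < ω m)
    (hρ : ∀ m, 0 ≤ ρ m) (p : T.FreeVertex) : 0 < T.stiffness ω ρ p p := by
  rw [stiffness_diag, form_self]
  have hnn : ∀ m ∈ Finset.univ, 0 ≤ ω m * (∫ x in G.sub m, ‖∇ (T.hat p.1) x‖ ^ 2) +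
      ρ m * ∫ x in G.sub m, T.hat p.1 x ^ 2 := fun m _ =>
    add_nonneg (mul_nonneg (hω m).le (energy_nonneg G _ m)) (mul_nonneg (hρ m) (mass_nonneg _ _))
  refine (Finset.sum_nonneg hnn).lt_of_ne fun h0 => ?_
  have hz := (Finset.sum_eq_zero_iff_of_nonneg hnn).1 h0.symm
  have hE : ∀ m, ∫ x in G.sub m, ‖∇ (T.hat p.1) x‖ ^ 2 = 0 := fun m => by
    have h1 := hz m (Finset.mem_univ m)
    have h2 := mul_nonneg (hρ m) (mass_nonneg (T.hat p.1) (G.sub m))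
    have h3 := energy_nonneg G (T.hat p.1) m
    have h4 := mul_nonneg (hω m).le h3
    have h5 : ω m * (∫ x in G.sub m, ‖∇ (T.hat p.1) x‖ ^ 2) = 0 := by linarith
    exact (mul_eq_zero.1 h5).resolve_left (hω m).ne'
  obtain ⟨C, -, hC⟩ := exists_friedrichs_const_Ω hd T
  have h1 := hC T _ (T.hat_mem p)
  simp only [hE, Finset.sum_const_zero, mul_zero] at h1
  obtain ⟨s, hs, hps⟩ := T.exists_facet p.2.1
  have hp : p.1 ∈ s := hps (Finset.mem_singleton_self _)
  have hcell : cell s ⊆ G.Ω := by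
    rw [← G.polyhedral.interior_closure, ← T.space_eq]
    exact interior_mono (T.K.convexHull_subset_space hs.1)
  have h2 := T.sum_sq_mul_volume_cell_le (T.hat_mem p) hs
  have h3 : ∫ x in cell s, T.hat p.1 x ^ 2 ≤ ∫ x in G.Ω, T.hat p.1 x ^ 2 :=
    setIntegral_mono_set (T.integrableOn_sq (T.hat_mem p) subset_closure)
      (Filter.Eventually.of_forall fun x => sq_nonneg _) (Filter.Eventually.of_forall hcell)
  have h4 : 0 < volume.real (cell s) :=
    ENNReal.toReal_pos ((isOpen_cell s).measure_pos volume (T.cell_nonempty hs)).ne'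
      (volume_cell_ne_top s)
  have h5 : 1 ≤ ∑ q ∈ s, T.hat p.1 q ^ 2 := by
    refine le_trans (le_of_eq ?_) (Finset.single_le_sum (fun q _ => sq_nonneg _) hp)
    rw [T.hat_vertex p.1 p.2.1, if_pos rfl, one_pow]
  have h6 : ∫ x in cell s, T.hat p.1 x ^ 2 ≤ 0 := h3.trans h1
  have h7 : (∑ q ∈ s, T.hat p.1 q ^ 2) * volume.real (cell s) ≤ 0 :=
    h2.trans (mul_nonpos_of_nonneg_of_nonpos (by positivity) h6)
  exact absurd h7 (not_le.2 (mul_pos (by linarith) h4))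

/-- The integral over a subdomain, as a functional of the nodal values. -/
noncomputable def subIntegral (m : Fin M) : (T.FreeVertex → ℝ) →ₗ[ℝ] ℝ :=
  LinearMap.comp
    { toFun := fun u : T.feSpace => ∫ x in G.sub m, u.1 x
      map_add' := fun u v => integral_add (T.integrableOn_fe u.2 (sub_subset_closure_Ω G m))
        (T.integrableOn_fe v.2 (sub_subset_closure_Ω G m))
      map_smul' := fun c _ => integral_const_mul c _ }
    T.nodalEquiv.symm.toLinearMap

end Triangulation

/-! ### Weighted mass bounds and assembly of the condition number estimates -/

theorem jump_bounds {M : ℕ} [Nonempty (Fin M)] {ω : Fin M → ℝ} (hω : ∀ m, 0 < ω m) :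
    0 < ⨅ m, ω m ∧ (∀ m, ⨅ m, ω m ≤ ω m) ∧ ∀ m, ω m ≤ ⨆ m, ω m := by
  obtain ⟨i, hi⟩ := exists_eq_ciInf_of_finite (f := ω)
  exact ⟨hi ▸ hω i, fun m => ciInf_le (Set.finite_range _).bddBelow m,
    fun m => le_ciSup (Set.finite_range _).bddAbove m⟩

theorem one_le_jump {M : ℕ} [Nonempty (Fin M)] {ω : Fin M → ℝ} (hω : ∀ m, 0 < ω m) :
    1 ≤ jump ω := by
  obtain ⟨h1, h2, h3⟩ := jump_bounds hω
  obtain ⟨m⟩ := ‹Nonempty (Fin M)›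
  exact (one_le_div h1).2 ((h2 m).trans (h3 m))

theorem ModelDomain.nonempty_index {d M : ℕ} (G : ModelDomain d M) : Nonempty (Fin M) := by
  obtain ⟨x, hx⟩ := G.polyhedral.isConnected.nonempty
  have h := subset_closure hx
  rw [G.closure_eq] at h
  exact ⟨(Set.mem_iUnion.1 h).choose⟩

/-- Bound the weights by `max ω` in the mass and by `min ω` in the energy; the quotient is the jump.
The factor `M` appears because the mass on each subdomain is bounded by that on all of `Ω`. -/
theorem weighted_mass_le {d M : ℕ} {G : ModelDomain d M} {T : Triangulation G} {C : ℝ} (hC : 0 ≤ C)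
    {u : Space d → ℝ} (hu : u ∈ T.feSpace) {ω : Fin M → ℝ} (hω : ∀ m, 0 < ω m)
    (h : ∫ x in G.Ω, u x ^ 2 ≤ C * ∑ m, ∫ x in G.sub m, ‖∇ u x‖ ^ 2) :
    ∑ m, ω m * ∫ y in G.sub m, u y ^ 2 ≤
      M * C * jump ω * ∑ m, ω m * ∫ y in G.sub m, ‖∇ u y‖ ^ 2 := by
  have := G.nonempty_index
  obtain ⟨h1, h2, h3⟩ := jump_bounds hω
  set a := ⨅ m, ω m
  set b := ⨆ m, ω m
  have hb : 0 ≤ b := (hω (Classical.arbitrary _)).le.trans (h3 _)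
  have hE : a * ∑ m, ∫ x in G.sub m, ‖∇ u x‖ ^ 2 ≤ ∑ m, ω m * ∫ y in G.sub m, ‖∇ u y‖ ^ 2 := by
    rw [Finset.mul_sum]
    exact Finset.sum_le_sum fun m _ =>
      mul_le_mul_of_nonneg_right (h2 m) (Triangulation.energy_nonneg G u m)
  have hm : ∀ m, ω m * ∫ y in G.sub m, u y ^ 2 ≤ b * ∫ x in G.Ω, u x ^ 2 := fun m =>
    mul_le_mul (h3 m) (setIntegral_mono_set (T.integrableOn_sq hu subset_closure)
      (Filter.Eventually.of_forall fun x => sq_nonneg _)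
      (Filter.Eventually.of_forall (Triangulation.sub_subset_Ω G m)))
      (Triangulation.mass_nonneg _ _) hb
  calc ∑ m, ω m * ∫ y in G.sub m, u y ^ 2 ≤ ∑ _m : Fin M, b * ∫ x in G.Ω, u x ^ 2 :=
        Finset.sum_le_sum fun m _ => hm m
    _ = M * b * ∫ x in G.Ω, u x ^ 2 := by
        rw [Finset.sum_const, Finset.card_univ, Fintype.card_fin, nsmul_eq_mul, mul_assoc]
    _ ≤ M * b * (C * ∑ m, ∫ x in G.sub m, ‖∇ u x‖ ^ 2) := by gcongr
    _ = M * C * jump ω * (a * ∑ m, ∫ x in G.sub m, ‖∇ u x‖ ^ 2) := by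
        have hj : jump ω = b / a := rfl
        rw [hj]
        field_simp
    _ ≤ _ := mul_le_mul_of_nonneg_left hE
        (mul_nonneg (mul_nonneg (Nat.cast_nonneg _) hC) (zero_le_one.trans (one_le_jump hω)))

theorem exists_subdomain_const {d M : ℕ} (hd : 0 < d) {G : ModelDomain d M}
    (T₀ : Triangulation G) (m : Fin M) :
    ∃ C : ℝ, 0 ≤ C ∧ ∀ T : Triangulation G, ∀ u ∈ T.feSpace,
      (m ∈ G.floating → ∫ x in G.sub m, u x = 0) →
      ∫ x in G.sub m, u x ^ 2 ≤ C * ∫ x in G.sub m, ‖∇ u x‖ ^ 2 := by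
  by_cases hm : m ∈ G.floating
  · obtain ⟨C, hC, h⟩ := Triangulation.exists_poincare_const G m
    exact ⟨C, hC, fun T u hu h0 => h T u hu (h0 hm)⟩
  · have hm' : surfaceMeasure d (frontier (G.sub m) ∩ G.ΓD) ≠ 0 := fun h =>
      hm (by simp [ModelDomain.floating, h])
    obtain ⟨C, hC, h⟩ := Triangulation.exists_friedrichs_const hd T₀ m hm'
    exact ⟨C, hC, fun T u hu _ => h T u hu⟩

end JacobiFEM

theorem theorem2p1 (d M : ℕ) (hd : d = 2 ∨ d = 3) (G : JacobiFEM.ModelDomain d M)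
    (σ : ℝ) (hσ : 0 < σ) :
    ∃ C : ℝ, 0 < C ∧
      ∀ T : JacobiFEM.Triangulation G, T.QuasiUniform σ →
      ∀ ω ρ : Fin M → ℝ, (∀ m, 0 < ω m) → (∀ m, 0 ≤ ρ m) →
        (JacobiFEM.sortedEigenvalues (T.jacobi ω ρ)).length = T.numDofs ∧
        (∀ k, 1 ≤ k → k ≤ T.numDofs → 0 < JacobiFEM.eigenvalue (T.jacobi ω ρ) k) ∧
        (0 < T.numDofs →
          JacobiFEM.condNumber (T.jacobi ω ρ) ≤ C * (T.meshSize ^ 2)⁻¹ * JacobiFEM.jump ω) ∧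
        (G.floating.card < T.numDofs →
          JacobiFEM.effCondNumber G.floating.card (T.jacobi ω ρ) ≤ C * (T.meshSize ^ 2)⁻¹) := by
  have hd0 : 0 < d := by omega
  -- Without any triangulation the claim is vacuous. Otherwise one is fixed, only to choose
  -- constants that serve all others.
  by_cases hT₀ : Nonempty (JacobiFEM.Triangulation G)
  swap
  · exact ⟨1, one_pos, fun T => (hT₀ ⟨T⟩).elim⟩
  obtain ⟨T₀⟩ := hT₀
  have := G.nonempty_index
  choose c hc0 hc using JacobiFEM.exists_subdomain_const hd0 T₀
  obtain ⟨c', hc'0, hc'⟩ := JacobiFEM.Triangulation.exists_friedrichs_const_Ω hd0 T₀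
  -- The sum dominates both each subdomain constant `c m` and the global constant `M * c'`, so that
  -- one `C` serves both estimates.
  set B : ℝ := ∑ m, c m + M * c' with hB
  have hcs : 0 ≤ ∑ m, c m := Finset.sum_nonneg fun m _ => hc0 m
  have hMc : 0 ≤ M * c' := mul_nonneg (Nat.cast_nonneg _) hc'0
  have hB0 : 0 ≤ B := add_nonneg hcs hMc
  set D := Metric.diam (closure G.Ω)
  set Q : ℝ := (d + 1) * 4 ^ (d + 1) * (4 / σ ^ 2 * B + D ^ 2) with hQ
  have hD : 0 < D := (T₀.meshSize_pos hd0).trans_le T₀.meshSize_le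
  have hQ0 : 0 < Q := by positivity
  refine ⟨(d + 1) * Q, by positivity, fun T hT ω ρ hω hρ => ?_⟩
  have hh := T.meshSize_pos hd0
  set h := T.meshSize
  have hJ := JacobiFEM.one_le_jump hω
  set J := JacobiFEM.jump ω
  have hJ0 : 0 < J := by linarith
  have hA := T.stiffness_isHermitian ω ρ
  have hdiag := T.stiffness_diag_pos hd0 hω hρ
  have hupper : ∀ k, 1 ≤ k → k ≤ T.numDofs →
      JacobiFEM.eigenvalue (T.jacobi ω ρ) k ≤ d + 1 := fun k hk hk' =>
    JacobiFEM.eigenvalue_le hA hdiag (T.dotProduct_stiffness_le hω hρ) hk hk'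
  have hlower : ∀ k, 1 ≤ k → k ≤ T.numDofs →
      (Q * J * (h ^ 2)⁻¹)⁻¹ ≤ JacobiFEM.eigenvalue (T.jacobi ω ρ) k := by
    intro k hk hk'
    -- No constraints are imposed, so the bound holds from `k = 1` on.
    refine JacobiFEM.le_eigenvalue hA hdiag (κ := Fin 0) 0 (fun x _ => ?_)
      (by rwa [Fintype.card_fin]) hk'
    have h1 := JacobiFEM.weighted_mass_le hc'0 (T.nodalEquiv.symm x).2 hω
      (hc' T _ (T.nodalEquiv.symm x).2)
    have h2 := T.sum_diag_le hσ hd0 hT hω hρ (B := M * c' * J) (by positivity) x h1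
    rw [inv_mul_le_iff₀ (by positivity)]
    have h3 : (0 : ℝ) ≤ dotProduct x ((T.stiffness ω ρ).mulVec x) := by
      rw [T.dotProduct_stiffness, JacobiFEM.Triangulation.form_self]
      exact Finset.sum_nonneg fun m _ => add_nonneg
        (mul_nonneg (hω m).le (JacobiFEM.Triangulation.energy_nonneg G _ m))
        (mul_nonneg (hρ m) (JacobiFEM.Triangulation.mass_nonneg _ _))
    refine h2.trans ?_
    -- Since `J ≥ 1`, the jump can be factored out of both summands.
    have h4 : 4 / σ ^ 2 * (M * c' * J) + D ^ 2 ≤ (4 / σ ^ 2 * B + D ^ 2) * J := by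
      have h5 : D ^ 2 ≤ D ^ 2 * J := le_mul_of_one_le_right (sq_nonneg _) hJ
      have h6 : 4 / σ ^ 2 * (M * c' * J) ≤ 4 / σ ^ 2 * (B * J) := by
        gcongr
        linarith
      linarith
    calc _ ≤ (d + 1) * 4 ^ (d + 1) * ((4 / σ ^ 2 * B + D ^ 2) * J) * (h ^ 2)⁻¹ *
          dotProduct x ((T.stiffness ω ρ).mulVec x) := by gcongr
      _ = _ := by rw [hQ]; ring
  refine ⟨JacobiFEM.length_sortedEigenvalues hA hdiag, fun k hk hk' => ?_, fun hN => ?_,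
    fun hN => ?_⟩
  · exact lt_of_lt_of_le (by positivity) (hlower k hk hk')
  · rw [JacobiFEM.condNumber]
    refine (div_le_div₀ (by positivity) (hupper _ hN le_rfl) (by positivity)
      (hlower 1 le_rfl hN)).trans_eq ?_
    rw [div_inv_eq_mul]
    ring
  · have hfl : (Q * (h ^ 2)⁻¹)⁻¹ ≤
        JacobiFEM.eigenvalue (T.jacobi ω ρ) (G.floating.card + 1) := by
      -- The constraints are the integrals over the floating subdomains. There are `m₀` of them, so
      -- the bound starts at index `m₀ + 1`.
      refine JacobiFEM.le_eigenvalue hA hdiag (κ := G.floating)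
        (LinearMap.pi fun m => T.subIntegral m.1) (fun x hx => ?_)
        (by rw [Fintype.card_coe]; omega) hN
      have h1 : ∑ m, ω m * ∫ y in G.sub m, (T.nodalEquiv.symm x).1 y ^ 2 ≤
          B * ∑ m, ω m * ∫ y in G.sub m, ‖∇ (T.nodalEquiv.symm x).1 y‖ ^ 2 := by
        rw [Finset.mul_sum]
        refine Finset.sum_le_sum fun m _ => ?_
        have h2 := hc m T _ (T.nodalEquiv.symm x).2 fun hm => congrFun hx ⟨m, hm⟩
        have h3 : c m ≤ B := (Finset.single_le_sum (fun m _ => hc0 m) (Finset.mem_univ m)).trans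
          (le_add_of_nonneg_right hMc)
        calc _ ≤ ω m * _ := mul_le_mul_of_nonneg_left (h2.trans (mul_le_mul_of_nonneg_right h3
              (JacobiFEM.Triangulation.energy_nonneg G _ m))) (hω m).le
          _ = _ := by ring
      rw [inv_mul_le_iff₀ (by positivity)]
      exact T.sum_diag_le hσ hd0 hT hω hρ hB0 x h1
    rw [JacobiFEM.effCondNumber]
    refine (div_le_div₀ (by positivity) (hupper _ (by omega) le_rfl) (by positivity)
      hfl).trans_eq ?_
    rw [div_inv_eq_mul]
    ring
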